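/- Let $r\ge 1$ be a fixed integer. For $n\ge r$ let $A\in\mathbb{R}^{r\times n}$ have full row rank, let $f:\mathbb{R}^r\to\mathbb{R}$ be convex, and let $\mathcal X\subseteq\mathbb{R}^n$ be such that the problem $$(P)\qquad \max\{f(Ax): x\in\mathcal X\}$$ has an optimal solution. For $x\in\mathbb{R}^n$ let $\mathrm{supp}(x)=\{i: x_i\ne 0\}$. The set $\mathcal X$ is called standard comonotone if for every permutation $\pi$ of $\{1,\dots,n\}$ and every $v\in\mathbb{R}^n$ with $v_{\pi(1)}\ge\cdots\ge v_{\pi(n)}$, whenever $\max_{x\in\mathcal X}v^\top x$ is attained, it is attained at some $x^*$ with $x^*_{\pi(1)}\ge\cdots\ge x^*_{\pi(n)}$. Consider in $\mathbb{R}^r\times\mathbb{R}$ the arrangement of the $n$ hyperplanes $H_i=\{(c,\lambda): (A^\top c)_i=\lambda\}$; its cells are the nonempty intersections obtained by choosing, for each $i$, either $H_i$ or one of its two open half-spaces. For $(c,\lambda)\in\mathbb{R}^r\times\mathbb{R}$ let $\mathcal Q_+(c,\lambda)$ be the set of all $x\in\mathbb{R}^n$ with $x\ge 0$ such that $x_i>0$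 if $(A^\top c)_i>\lambda$, $x_i=0$ if $(A^\top c)_i<\lambda$, and $x_i\ge x_j$ if $i<j$ and $(A^\top c)_i=(A^\top c)_j=\lambda$. The candidate supports are the sets $\mathrm{supp}(x)$ with $x\in\mathcal Q_+(c,\lambda)$ and $(c,\lambda)$ in some cell of the arrangement; they depend only on $A$. (i) There is a constant $C_r$, depending only on $r$, such that there are at most $C_r n^r$ candidate supports; and for all $\mathcal X$ and $f$ as above such that $\mathcal X$ consists of nonnegative vectors and is standard comonotone, at least one of the candidate supports is the support of an optimal solution of $(P)$. (ii) Assume a support oracle: given $S\subseteq\{1,\dots,n\}$, it either returns an optimal solution of $\max\{f(Ax): x\in\mathcal X,\ \mathrm{supp}(x)=S\}$ together with its value, or reports that no optimal solution of this subproblem exists. Each call takes $T_1$ steps, where $T_1\ge n$ (a call has to read $S$ and to be able to write a vector of length $n$). Then $(P)$ is solvable in time $O(n^r\cdot T_1)$: there are a constant $C'_r$ and a program for a real random access machine (unit-cost exact real arithmetic and comparisons, unit-cost addition, subtraction and comparison of natural numbers, and indexed memory) with access to the oracle, both depending only on $r$, such that for all $n$, $A$, $f$, $\mathcal X$ as above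 with $\mathcal X$ nonnegative and standard comonotone, for every support oracle and every $T_1\ge n$, the program on input $n$, $A$ halts after at most $C'_r\, n^r\, T_1$ steps and outputs an optimal solution of $(P)$. In particular, for fixed $r$ it runs in polynomial time whenever $T_1$ is polynomial in $n$. -/

import Mathlib

namespace FixedRank

/-! ### Standard comonotone sets and the convex maximization problem -/

/-- The cone of the vectors sorted by `π`, i.e. `x (π 1) ≥ ... ≥ x (π n)`. -/
def sortedCone {n : ℕ} (π : Equiv.Perm (Fin n)) : Set (Fin n → ℝ) :=
  {x | ∀ i j : Fin n, i ≤ j → x (π j) ≤ x (π i)}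

/-- `x` is an optimal solution of the problem of maximizing `g` over `X`. -/
def IsOptimalSol {α : Type*} (g : α → ℝ) (X : Set α) (x : α) : Prop :=
  x ∈ X ∧ ∀ y ∈ X, g y ≤ g x

/-- `X` is standard comonotone: for every permutation `π` and every cost vector `v` sorted by `π`,
if `max {vᵀx : x ∈ X}` is attained, then it is attained at some point sorted by `π`. -/
def StandardComonotone {n : ℕ} (X : Set (Fin n → ℝ)) : Prop :=
  ∀ π : Equiv.Perm (Fin n), ∀ v ∈ sortedCone π,
    (∃ x, IsOptimalSol (fun x => v ⬝ᵥ x) X x) →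
      ∃ x, IsOptimalSol (fun x => v ⬝ᵥ x) X x ∧ x ∈ sortedCone π

/-- `supp x`, the set of the indices of the nonzero entries of `x`. -/
noncomputable def supp {n : ℕ} (x : Fin n → ℝ) : Finset (Fin n) :=
  {i | x i ≠ 0}

/-- The objective `x ↦ f (A x)`. -/
def objective {r n : ℕ} (A : Matrix (Fin r) (Fin n) ℝ) (f : (Fin r → ℝ) → ℝ)
    (x : Fin n → ℝ) : ℝ :=
  f (A.mulVec x)

/-! ### The single-threshold lifted arrangement and its candidate supports -/

/-- `(Aᵀ c)_i - lam`, whose zero set is the `i`-th hyperplane of the lifted space `ℝ^r × ℝ`. -/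
def lifted {r n : ℕ} (A : Matrix (Fin r) (Fin n) ℝ) (i : Fin n) (p : (Fin r → ℝ) × ℝ) : ℝ :=
  A.transpose.mulVec p.1 i - p.2

/-- The intersection, over `i`, of the `i`-th hyperplane (`s i = 0`), its positive open half-space
(`s i = 1`) or its negative open half-space (`s i = -1`). -/
def cell {r n : ℕ} (A : Matrix (Fin r) (Fin n) ℝ) (s : Fin n → SignType) :
    Set ((Fin r → ℝ) × ℝ) :=
  {p | ∀ i, SignType.sign (lifted A i p) = s i}

/-- The arrangement of the `n` hyperplanes `(Aᵀ c)_i = lam`: the collection of its (nonempty)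
cells, of all dimensions. -/
def arrangement {r n : ℕ} (A : Matrix (Fin r) (Fin n) ℝ) : Set (Set ((Fin r → ℝ) × ℝ)) :=
  {R | R.Nonempty ∧ ∃ s : Fin n → SignType, R = cell A s}

/-- The thresholding conditions at `(c, lam)`: nonnegative vectors that are positive where
`(Aᵀ c)_i > lam`, zero where `(Aᵀ c)_i < lam`, and nonincreasing in the index on the ties
`(Aᵀ c)_i = lam`. -/
def thresholdSet {r n : ℕ} (A : Matrix (Fin r) (Fin n) ℝ) (p : (Fin r → ℝ) × ℝ) :
    Set (Fin n → ℝ) :=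
  {x | (∀ i, 0 ≤ x i) ∧
    (∀ i, p.2 < A.transpose.mulVec p.1 i → 0 < x i) ∧
    (∀ i, A.transpose.mulVec p.1 i < p.2 → x i = 0) ∧
    (∀ i j, i < j → A.transpose.mulVec p.1 i = p.2 → A.transpose.mulVec p.1 j = p.2 →
      x j ≤ x i)}

/-- The candidate supports contributed by a cell `R`. -/
def cellSupports {r n : ℕ} (A : Matrix (Fin r) (Fin n) ℝ) (R : Set ((Fin r → ℝ) × ℝ)) :
    Set (Finset (Fin n)) :=
  {S | ∃ p ∈ R, ∃ x ∈ thresholdSet A p, supp x = S}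

/-- The candidate supports contributed by all cells of the arrangement; they depend only on `A`. -/
def candidateSupports {r n : ℕ} (A : Matrix (Fin r) (Fin n) ℝ) : Set (Finset (Fin n)) :=
  ⋃ R ∈ arrangement A, cellSupports A R

/-! ### The support oracle -/

/-- `ans` solves every fixed-support subproblem `max {f (A x) : x ∈ X, supp x = S}`: it returns an
optimal solution together with the optimal value if the optimum is attained, and otherwise reports
(by `none`) that there is no optimal solution. -/
def IsSupportOracle {r n : ℕ} (A : Matrix (Fin r) (Fin n) ℝ) (f : (Fin r → ℝ) → ℝ)
    (X : Set (Fin n → ℝ)) (ans : Finset (Fin n) → Option ((Fin n → ℝ) × ℝ)) : Prop :=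
  ∀ S : Finset (Fin n),
    (∀ x t, ans S = some (x, t) →
      IsOptimalSol (objective A f) {x | x ∈ X ∧ supp x = S} x ∧ t = objective A f x) ∧
    (ans S = none → ¬ ∃ x, IsOptimalSol (objective A f) {x | x ∈ X ∧ supp x = S} x)

/-! ### Programs of a real random access machine with an oracle

The memory consists of arrays of natural numbers and arrays of real numbers.  The machine performs,
at unit cost each, memory accesses with computed indices, addition, truncated subtraction and
comparison of natural numbers, and exact arithmetic and comparison of real numbers.  A program is a
finite text that knows neither the dimension `n` nor the data.  The only loops are bounded ones, so
that every program halts. -/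

/-- The contents of the memory: `nat a i` and `real a i` are the `i`-th entries of the arrays
number `a`. -/
structure Memory where
  nat : ℕ → ℕ → ℕ
  real : ℕ → ℕ → ℝ

/-- `nat a i := k`. -/
def Memory.setNat (m : Memory) (a i k : ℕ) : Memory :=
  { m with nat := fun b j => if b = a ∧ j = i then k else m.nat b j }

/-- `real a i := t`. -/
noncomputable def Memory.setReal (m : Memory) (a i : ℕ) (t : ℝ) : Memory :=
  { m with real := fun b j => if b = a ∧ j = i then t else m.real b j }

/-- Write the vector `x` to the first `n` entries of the real array `a`. -/
noncomputable def Memory.setVec {n : ℕ} (m : Memory) (a : ℕ) (x : Fin n → ℝ) : Memory :=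
  { m with real := fun b j => if h : b = a ∧ j < n then x ⟨j, h.2⟩ else m.real b j }

/-- Expressions for natural numbers. -/
inductive NatExpr where
  | const (k : ℕ)
  | get (a : ℕ) (i : NatExpr)
  | add (e₁ e₂ : NatExpr)
  | sub (e₁ e₂ : NatExpr)

def NatExpr.eval (m : Memory) : NatExpr → ℕ
  | .const k => k
  | .get a i => m.nat a (i.eval m)
  | .add e₁ e₂ => e₁.eval m + e₂.eval m
  | .sub e₁ e₂ => e₁.eval m - e₂.eval m

/-- The number of steps taken to evaluate the expression. -/
def NatExpr.cost : NatExpr → ℕ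
  | .const _ => 1
  | .get _ i => i.cost + 1
  | .add e₁ e₂ => e₁.cost + e₂.cost + 1
  | .sub e₁ e₂ => e₁.cost + e₂.cost + 1

/-- Expressions for real numbers; the only constants are natural numbers. -/
inductive RealExpr where
  | const (k : ℕ)
  | get (a : ℕ) (i : NatExpr)
  | add (e₁ e₂ : RealExpr)
  | sub (e₁ e₂ : RealExpr)
  | mul (e₁ e₂ : RealExpr)
  | div (e₁ e₂ : RealExpr)

noncomputable def RealExpr.eval (m : Memory) : RealExpr → ℝ
  | .const k => (k : ℝ)
  | .get a i => m.real a (i.eval m)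
  | .add e₁ e₂ => e₁.eval m + e₂.eval m
  | .sub e₁ e₂ => e₁.eval m - e₂.eval m
  | .mul e₁ e₂ => e₁.eval m * e₂.eval m
  | .div e₁ e₂ => e₁.eval m / e₂.eval m

/-- The number of steps taken to evaluate the expression. -/
def RealExpr.cost : RealExpr → ℕ
  | .const _ => 1
  | .get _ i => i.cost + 1
  | .add e₁ e₂ => e₁.cost + e₂.cost + 1
  | .sub e₁ e₂ => e₁.cost + e₂.cost + 1
  | .mul e₁ e₂ => e₁.cost + e₂.cost + 1
  | .div e₁ e₂ => e₁.cost + e₂.cost + 1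

/-- Programs.
* `setNat a i e`, `setReal a i e`: assign the value of `e` to the entry `i` of the array `a`;
* `ifNatLt e₁ e₂ P Q`, `ifRealLt e₁ e₂ P Q`: if `e₁ < e₂` then `P` else `Q`;
* `loop a e P`: evaluate `e` once, to `k` say, and run `P` for `nat a 0 = 0, 1, ..., k - 1`;
* `query s b x t`: call the oracle on the set `{i < n : nat s i ≠ 0}`.  If it returns a solution,
  set `nat b 0 := 1`, write the solution to the real array `x` and its value to `real t 0`;
  otherwise set `nat b 0 := 0`. -/
inductive Program where
  | skip
  | setNat (a : ℕ) (i e : NatExpr)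
  | setReal (a : ℕ) (i : NatExpr) (e : RealExpr)
  | seq (P Q : Program)
  | ifNatLt (e₁ e₂ : NatExpr) (P Q : Program)
  | ifRealLt (e₁ e₂ : RealExpr) (P Q : Program)
  | loop (a : ℕ) (e : NatExpr) (P : Program)
  | query (s b x t : ℕ)

/-- The memory after `k` rounds of a loop with counter `nat a 0`, where `body` is the effect of the
body of the loop on the memory. -/
def loopMemory (a : ℕ) (body : Memory → Memory) (m : Memory) : ℕ → Memory
  | 0 => m
  | k + 1 => body ((loopMemory a body m k).setNat a 0 k)

/-- The set whose indicator is stored in the first `n` entries of the natural-number array `s`. -/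
def Memory.readSet (m : Memory) (n s : ℕ) : Finset (Fin n) :=
  {i | m.nat s i ≠ 0}

/-- The memory after an oracle call that returned `y`. -/
noncomputable def Memory.writeAnswer {n : ℕ} (m : Memory) (b x t : ℕ) :
    Option ((Fin n → ℝ) × ℝ) → Memory
  | none => m.setNat b 0 0
  | some y => ((m.setNat b 0 1).setVec x y.1).setReal t 0 y.2

open Classical in
/-- The memory after running a program with the oracle `ans`. -/
noncomputable def Program.exec {n : ℕ} (ans : Finset (Fin n) → Option ((Fin n → ℝ) × ℝ)) :
    Program → Memory → Memory
  | .skip, m => m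
  | .setNat a i e, m => m.setNat a (i.eval m) (e.eval m)
  | .setReal a i e, m => m.setReal a (i.eval m) (e.eval m)
  | .seq P Q, m => Q.exec ans (P.exec ans m)
  | .ifNatLt e₁ e₂ P Q, m => if e₁.eval m < e₂.eval m then P.exec ans m else Q.exec ans m
  | .ifRealLt e₁ e₂ P Q, m => if e₁.eval m < e₂.eval m then P.exec ans m else Q.exec ans m
  | .loop a e P, m => loopMemory a (P.exec ans) m (e.eval m)
  | .query s b x t, m => m.writeAnswer b x t (ans (m.readSet n s))

open Classical in
/-- The number of steps of a program run with the oracle `ans`, where each oracle call takes `T`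
steps. -/
noncomputable def Program.time {n : ℕ} (ans : Finset (Fin n) → Option ((Fin n → ℝ) × ℝ)) (T : ℕ) :
    Program → Memory → ℕ
  | .skip, _ => 1
  | .setNat _ i e, _ => i.cost + e.cost + 1
  | .setReal _ i e, _ => i.cost + e.cost + 1
  | .seq P Q, m => P.time ans T m + Q.time ans T (P.exec ans m)
  | .ifNatLt e₁ e₂ P Q, m =>
      e₁.cost + e₂.cost + 1 +
        if e₁.eval m < e₂.eval m then P.time ans T m else Q.time ans T m
  | .ifRealLt e₁ e₂ P Q, m =>
      e₁.cost + e₂.cost + 1 +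
        if e₁.eval m < e₂.eval m then P.time ans T m else Q.time ans T m
  | .loop a e P, m =>
      e.cost + 1 + ∑ k ∈ Finset.range (e.eval m),
        (1 + P.time ans T ((loopMemory a (P.exec ans) m k).setNat a 0 k))
  | .query _ _ _ _, _ => T

/-- The initial memory: `nat 0 0` holds `n`, the real array `k < r` holds the row `k` of `A`, and
everything else is zero. -/
noncomputable def inputMemory {r n : ℕ} (A : Matrix (Fin r) (Fin n) ℝ) : Memory where
  nat := fun a i => if a = 0 ∧ i = 0 then n else 0
  real := fun a i => if h : a < r ∧ i < n then A ⟨a, h.1⟩ ⟨i, h.2⟩ else 0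

/-- The output: the first `n` entries of the real array number `a`. -/
def Memory.readVec (m : Memory) (n a : ℕ) : Fin n → ℝ :=
  fun i => m.real a i

end FixedRank

/-!
**Candidates contain an optimum.** Let `x₀` be optimal for `max f(Ax)` and let `c` be a subgradient
of `f` at `A x₀`. Then `x₀` maximizes the linear cost `v = Aᵀ c` over `X`, and conversely every
maximizer of this cost is optimal for the convex problem. Comonotonicity, applied to the order that
sorts `v` with ties broken by the index, gives a maximizer in this order. Its support is an initial
segment of the order, hence a candidate support, with the smallest entry of `v` on the support as
the threshold (`exists_optimal_supp_mem_candidateSupports`).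

**Candidates have short descriptions.** With `b_i = (a_i, 1)`, where `a_i` is the `i`-th column of
`A`, and `q = (c, -lam)`, a candidate support consists of the indices with `q ⬝ b_i > 0` and an
initial segment of those with `q ⬝ b_i = 0`. If `q` vanishes on no nonzero `b_i`, move it in the
direction of a coordinate `e_j` until, for the first time, it vanishes on some `b_{i₀}` with
`b_{i₀} j ≠ 0`. No sign flips on the way, and the signs lost in the limit are those of `± b_i j`
(`exists_pivot`). A functional vanishing on `b_{i₀}` is unchanged by the Gaussian elimination of the
coordinate `j` with pivot `b_{i₀}`, so the dimension drops by one. Starting from dimension `r + 1`,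
after `r` rounds one coordinate is left, so the signs are determined by `r` pivots and boundedly
many further choices (`exists_codeSign`). The end of the initial segment of the ties costs no
further index, because an index with `q ⬝ b_i = 0` can be taken as the first pivot
(`exists_codeSet_eq`). This gives the bound `O(n ^ r)` without any count of cells.

**The program** runs through all `n ^ r` tuples of pivots in `r` nested loops, and for every tuple
through the finitely many remaining choices, which are unrolled in the program text. The entries
after the eliminations are rational expressions of bounded size in the entries of `A`, so each set
is computed in `O(n)` steps and passed to the oracle (`polyTime_enumerateCodes`). Correctness
follows two invariants: the stored solution is feasible with its stored value, and once the
support of an optimal solution has been tried, the stored value is optimal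
(`isOptimalSol_exec_enumerateCodes`).
-/

namespace FixedRank

/-! ### Subgradients and optimal solutions with a candidate support -/

/-- A finite convex function on a finite-dimensional space has a subgradient at every point. -/
theorem exists_subgradient {r : ℕ} {f : (Fin r → ℝ) → ℝ} (hf : ConvexOn ℝ Set.univ f)
    (y₀ : Fin r → ℝ) : ∃ c : Fin r → ℝ, ∀ y, f y₀ + c ⬝ᵥ (y - y₀) ≤ f y := by
  have hcont : Continuous f := by
    rw [← continuousOn_univ]
    exact hf.continuousOn isOpen_univ
  have hopen : IsOpen {p : (Fin r → ℝ) × ℝ | p.1 ∈ Set.univ ∧ f p.1 < p.2} := by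
    simpa using isOpen_lt (hcont.comp continuous_fst) continuous_snd
  obtain ⟨L, hL⟩ := geometric_hahn_banach_point_open (x := (y₀, f y₀))
    hf.convex_strict_epigraph hopen (by simp)
  have hL' : ∀ y t, f y < t → L (y₀, f y₀) < L (y, t) := fun y t h => hL (y, t) (by simpa using h)
  have hsplit : ∀ y t, L (y, t) = L (y, 0) + t * L (0, 1) := by
    intro y t
    rw [← smul_eq_mul, ← map_smul, ← map_add]
    simp
  have hpos : 0 < L (0, 1) := by
    have h := hL' y₀ (f y₀ + 1) (by linarith)
    rw [hsplit, hsplit y₀ (f y₀ + 1)] at h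
    linarith
  -- closing the strict epigraph: the separating inequality persists at `t = f y`
  have hle : ∀ y, L (y₀, f y₀) ≤ L (y, f y) := by
    intro y
    refine le_of_forall_pos_le_add fun ε hε => ?_
    have h := hL' y (f y + ε / L (0, 1)) (by have := div_pos hε hpos; linarith)
    rw [hsplit y (f y + _), add_mul, div_mul_cancel₀ _ hpos.ne', ← add_assoc, ← hsplit] at h
    exact h.le
  refine ⟨fun k => -(L (Pi.single k 1, 0)) / L (0, 1), fun y => ?_⟩
  have hlin : ∀ z : Fin r → ℝ, L (z, 0) = ∑ k, z k * L (Pi.single k 1, 0) := by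
    intro z
    have := congrArg (fun w => (L.comp (.inl ℝ _ ℝ)) w) (pi_eq_sum_univ' z)
    simp only [map_sum, map_smul] at this
    simpa using this
  have hdot : (fun k => -(L (Pi.single k 1, 0)) / L (0, 1)) ⬝ᵥ (y - y₀) =
      -(L (y, 0) - L (y₀, 0)) / L (0, 1) := by
    rw [hlin y, hlin y₀, ← Finset.sum_sub_distrib, ← Finset.sum_neg_distrib, Finset.sum_div]
    refine Finset.sum_congr rfl fun k _ => ?_
    simp only [Pi.sub_apply]
    ring
  have h := hle y
  rw [hsplit y₀, hsplit y] at h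
  rw [hdot, ← le_sub_iff_add_le', div_le_iff₀ hpos]
  linarith

/-- A nonnegative vector sorted by a permutation `π`, which in turn sorts `v` and breaks ties by the
index, satisfies the thresholding conditions for `v = Aᵀ c` at a suitable threshold. -/
theorem exists_mem_thresholdSet {r n : ℕ} (A : Matrix (Fin r) (Fin n) ℝ) (c : Fin r → ℝ)
    (π : Equiv.Perm (Fin n)) (hv : A.transpose.mulVec c ∈ sortedCone π)
    (hπ : ∀ i j, i < j → A.transpose.mulVec c i = A.transpose.mulVec c j → π.symm i < π.symm j)
    {x : Fin n → ℝ} (hx0 : ∀ i, 0 ≤ x i) (hx : x ∈ sortedCone π) :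
    ∃ lam, x ∈ thresholdSet A (c, lam) := by
  set v := A.transpose.mulVec c with hvdef
  have hvle : ∀ i j, π.symm i ≤ π.symm j → v j ≤ v i := fun i j h => by
    simpa using hv _ _ h
  have hxle : ∀ i j, π.symm i ≤ π.symm j → x j ≤ x i := fun i j h => by
    simpa using hx _ _ h
  by_cases hne : ∃ i, 0 < x i
  · -- the threshold is the smallest entry of `v` on the support of `x`
    obtain ⟨i₀, hi₀, hmin⟩ := Finset.exists_min_image
      (Finset.univ.filter fun i => 0 < x i) v (by simpa [Finset.Nonempty] using hne)
    simp only [Finset.mem_filter, Finset.mem_univ, true_and] at hi₀ hmin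
    refine ⟨v i₀, hx0, fun i hi => ?_, fun i hi => ?_, fun i j hij h₁ h₂ => ?_⟩
    · have : π.symm i ≤ π.symm i₀ := by
        by_contra h
        exact absurd (hvle i₀ i (not_le.1 h).le) (not_le.2 hi)
      exact hi₀.trans_le (hxle _ _ this)
    · by_contra h
      exact absurd (hmin i ((hx0 i).lt_of_ne' h)) (not_le.2 hi)
    · exact hxle _ _ (hπ i j hij (h₁.trans h₂.symm)).le
  · push Not at hne
    have hxz : ∀ i, x i = 0 := fun i => le_antisymm (hne i) (hx0 i)
    obtain ⟨M, hM⟩ := (Set.finite_range v).bddAbove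
    refine ⟨M + 1, hx0, fun i hi => ?_, fun i _ => hxz i, fun i j _ _ _ => by simp [hxz]⟩
    have h1 : v i ≤ M := hM ⟨i, rfl⟩
    have h2 : M + 1 < v i := hi
    linarith

/-- Every vector is sorted by a permutation that breaks ties by the index. -/
theorem exists_sorting_perm {n : ℕ} (v : Fin n → ℝ) :
    ∃ π : Equiv.Perm (Fin n), v ∈ sortedCone π ∧
      ∀ i j, i < j → v i = v j → π.symm i < π.symm j := by
  refine ⟨Tuple.sort (fun i => -v i), fun i j hij => ?_, fun i j hij h => ?_⟩
  · have := Tuple.monotone_sort (fun i => -v i) hij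
    simpa using this
  · by_contra hlt
    rcases (not_lt.1 hlt).lt_or_eq with h' | h'
    · have := (Tuple.eq_sort_iff (f := fun i => -v i)).1 rfl |>.2 _ _ h' (by simp [h])
      simp at this
      exact absurd hij this.asymm
    · exact hij.ne' ((Tuple.sort fun i => -v i).symm.injective h')

theorem mem_candidateSupports {r n : ℕ} {A : Matrix (Fin r) (Fin n) ℝ} {S : Finset (Fin n)} :
    S ∈ candidateSupports A ↔ ∃ p, ∃ x ∈ thresholdSet A p, supp x = S := by
  constructor
  · intro h
    simp only [candidateSupports, Set.mem_iUnion] at h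
    obtain ⟨R, -, p, -, x, hx, rfl⟩ := h
    exact ⟨p, x, hx, rfl⟩
  · rintro ⟨p, x, hx, rfl⟩
    simp only [candidateSupports, Set.mem_iUnion]
    have hp : p ∈ cell A fun i => SignType.sign (lifted A i p) := fun i => rfl
    exact ⟨_, ⟨⟨p, hp⟩, _, rfl⟩, p, hp, x, hx, rfl⟩

/-- For an optimal `x₀` and a subgradient `c` of `f` at `A x₀`, the linear cost `Aᵀ c` is maximized
over `X` by `x₀`; a sorted maximizer of this cost is again optimal for the convex problem, and its support
is a candidate. -/
theorem exists_optimal_supp_mem_candidateSupports {r n : ℕ} (A : Matrix (Fin r) (Fin n) ℝ)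
    {X : Set (Fin n → ℝ)} {f : (Fin r → ℝ) → ℝ} (hX0 : ∀ x ∈ X, ∀ i, 0 ≤ x i)
    (hX : StandardComonotone X) (hf : ConvexOn ℝ Set.univ f)
    (hopt : ∃ x, IsOptimalSol (objective A f) X x) :
    ∃ x, IsOptimalSol (objective A f) X x ∧ supp x ∈ candidateSupports A := by
  obtain ⟨x₀, hx₀, hmax⟩ := hopt
  obtain ⟨c, hc⟩ := exists_subgradient hf (A.mulVec x₀)
  have hdot : ∀ x, A.transpose.mulVec c ⬝ᵥ x = c ⬝ᵥ A.mulVec x := fun x => by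
    rw [Matrix.mulVec_transpose, Matrix.dotProduct_mulVec]
  obtain ⟨π, hπ, htie⟩ := exists_sorting_perm (A.transpose.mulVec c)
  obtain ⟨x, ⟨hxX, hxmax⟩, hxs⟩ := hX π _ hπ ⟨x₀, hx₀, fun y hy => by
    have h1 := hc (A.mulVec y)
    have h2 : f (A.mulVec y) ≤ f (A.mulVec x₀) := hmax y hy
    rw [dotProduct_sub] at h1
    simp only [hdot]
    linarith⟩
  refine ⟨x, ⟨hxX, fun y hy => (hmax y hy).trans ?_⟩, mem_candidateSupports.2 ?_⟩
  · have h1 := hc (A.mulVec x)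
    have h2 := hxmax x₀ hx₀
    simp only [hdot] at h2
    rw [dotProduct_sub] at h1
    change f (A.mulVec x₀) ≤ f (A.mulVec x)
    linarith
  · obtain ⟨lam, h⟩ := exists_mem_thresholdSet A c π hπ htie (hX0 x hxX) hxs
    exact ⟨_, x, h, rfl⟩

/-! ### Encoding sign patterns of linear functionals -/

section Codes

variable {ι κ : Type*}

/-- Eliminate the coordinate `j` from the vectors `b i` with the pivot `b i₀`.  When the pivot entry
`b i₀ j` is zero, nothing happens. -/
noncomputable def elim (b : ι → κ → ℝ) (i₀ : ι) (j : κ) : ι → κ → ℝ :=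
  fun i k => b i k - b i j / b i₀ j * b i₀ k

/-- The sign assigned to `b i` by a code: a list of pairs of a coordinate `j` and a sign `τ`,
together with a list of pivots. The pair `(j, τ)` and the pivot `i₀` stand for a functional
`q + ε τ e_j`, where `q` vanishes on `b i₀` and is described, on the vectors `elim b i₀ j`, by the
rest of the code, and `ε > 0` is infinitesimal. So the rest of the code decides, and `τ * b i j`
only breaks ties. A last pair without a pivot stands for the functional `τ e_j`. -/
noncomputable def codeSign : List (κ × SignType) → List ι → (ι → κ → ℝ) → ι → SignType
  | [], _, _, _ => 0
  | (j, τ) :: _, [], b, i => τ * SignType.sign (b i j)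
  | (j, τ) :: L, i₀ :: I, b, i =>
      if codeSign L I (elim b i₀ j) i = 0 then τ * SignType.sign (b i j)
      else codeSign L I (elim b i₀ j) i

/-- A functional that vanishes on the pivot takes the same values after the elimination, where the
eliminated coordinate is not needed any more. -/
theorem sum_erase_elim [DecidableEq κ] {J : Finset κ} {j : κ} (hj : j ∈ J) {b : ι → κ → ℝ}
    {q : κ → ℝ} {i₀ i : ι} (h0 : ∑ k ∈ J, q k * b i₀ k = 0) (hij : b i₀ j = 0 → b i j = 0) :
    ∑ k ∈ J.erase j, q k * elim b i₀ j i k = ∑ k ∈ J, q k * b i k := by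
  have h1 : elim b i₀ j i j = 0 := by
    unfold elim
    by_cases h : b i₀ j = 0
    · simp [h, hij h]
    · field_simp; ring
  have h2 : ∑ k ∈ J, q k * elim b i₀ j i k = ∑ k ∈ J, q k * b i k := by
    have : ∀ k, q k * elim b i₀ j i k = q k * b i k - b i j / b i₀ j * (q k * b i₀ k) := by
      intro k; unfold elim; ring
    simp only [this]
    rw [Finset.sum_sub_distrib, ← Finset.mul_sum, h0]
    ring
  rw [← h2, ← Finset.add_sum_erase _ _ hj, h1]
  ring

/-- Subtracting a number of at most the same absolute value can cancel `x` but not flip its sign. -/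
theorem sign_eq_of_abs_le {x y : ℝ} (h : |y| ≤ |x|) :
    SignType.sign x =
      if SignType.sign (x - y) = 0 then SignType.sign y else SignType.sign (x - y) := by
  split_ifs with h0
  · rw [sign_eq_zero_iff, sub_eq_zero] at h0
    rw [h0]
  · rw [sign_eq_zero_iff] at h0
    rcases lt_trichotomy x 0 with hx | hx | hx
    · rw [abs_of_neg hx] at h
      have : x - y < 0 := lt_of_le_of_ne (by have := neg_abs_le y; linarith) h0
      rw [sign_neg hx, sign_neg this]
    · subst hx
      have : y = 0 := by simpa using h
      simp [this] at h0
    · rw [abs_of_pos hx] at h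
      have : 0 < x - y := lt_of_le_of_ne (by have := le_abs_self y; linarith) (Ne.symm h0)
      rw [sign_pos hx, sign_pos this]

/-- A linear functional is, up to its signs on the vectors `b i`, the perturbation in one
coordinate direction of a functional `q'` that vanishes on some `b i₀`.  If `q` itself vanishes on a
nonzero `b i₀`, no perturbation is needed; otherwise `q` is moved in a coordinate direction until
this happens for the first time. -/
theorem exists_pivot [DecidableEq κ] {s : Finset ι} (hs : s.Nonempty) {J : Finset κ}
    (hJ : J.Nonempty) (b : ι → κ → ℝ) (q : κ → ℝ) :
    ∃ i₀ ∈ s, ∃ j ∈ J, ∃ (τ : SignType) (q' : κ → ℝ), ∑ k ∈ J, q' k * b i₀ k = 0 ∧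
      ∀ i ∈ s, (b i₀ j = 0 → b i j = 0) ∧ SignType.sign (∑ k ∈ J, q k * b i k) =
        if SignType.sign (∑ k ∈ J, q' k * b i k) = 0 then τ * SignType.sign (b i j)
        else SignType.sign (∑ k ∈ J, q' k * b i k) := by
  by_cases hz : ∀ i ∈ s, ∀ k ∈ J, b i k = 0
  · obtain ⟨i₀, hi₀⟩ := hs
    obtain ⟨j, hj⟩ := hJ
    have hq : ∀ i ∈ s, ∑ k ∈ J, q k * b i k = 0 := fun i hi =>
      Finset.sum_eq_zero fun k hk => by rw [hz i hi k hk, mul_zero]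
    exact ⟨i₀, hi₀, j, hj, 0, q, hq i₀ hi₀, fun i hi => ⟨fun _ => hz i hi j hj, by simp [hq i hi]⟩⟩
  push Not at hz
  obtain ⟨i₁, hi₁, j, hj, hij⟩ := hz
  obtain ⟨i₀, hi₀, hmin⟩ := Finset.exists_min_image (s.filter fun i => b i j ≠ 0)
    (fun i => |(∑ k ∈ J, q k * b i k) / b i j|) ⟨i₁, by simp [hi₁, hij]⟩
  simp only [Finset.mem_filter] at hi₀ hmin
  set t := (∑ k ∈ J, q k * b i₀ k) / b i₀ j with ht
  have hsum : ∀ i, ∑ k ∈ J, (q k - if k = j then t else 0) * b i k =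
      ∑ k ∈ J, q k * b i k - t * b i j := by
    intro i
    simp only [sub_mul, Finset.sum_sub_distrib, ite_mul, zero_mul]
    rw [Finset.sum_ite_eq' J j, if_pos hj]
  refine ⟨i₀, hi₀.1, j, hj, SignType.sign t, fun k => q k - if k = j then t else 0, ?_,
    fun i hi => ⟨fun h => absurd h hi₀.2, ?_⟩⟩
  · rw [hsum, ht, div_mul_cancel₀ _ hi₀.2, sub_self]
  · rw [hsum, ← sign_mul]
    apply sign_eq_of_abs_le
    by_cases h : b i j = 0
    · simp [h]
    · have := hmin i ⟨hi, h⟩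
      rwa [abs_div _ (b i j), le_div_iff₀ (abs_pos.2 h), ← abs_mul] at this

/-- Every sign pattern of a linear functional on finitely many vectors of dimension `d + 1` has a
code with `d` pivots. -/
theorem exists_codeSign [DecidableEq κ] {s : Finset ι} (hs : s.Nonempty) (d : ℕ) :
    ∀ (J : Finset κ), J.card = d + 1 → ∀ (b : ι → κ → ℝ) (q : κ → ℝ),
      ∃ (L : List (κ × SignType)) (I : List ι), L.length = d + 1 ∧ I.length = d ∧
        (∀ i ∈ I, i ∈ s) ∧ ∀ i ∈ s, SignType.sign (∑ k ∈ J, q k * b i k) = codeSign L I b i := by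
  induction d with
  | zero =>
    intro J hJ b q
    obtain ⟨j, rfl⟩ := Finset.card_eq_one.1 hJ
    exact ⟨[(j, SignType.sign (q j))], [], rfl, rfl, by simp,
      fun i _ => by simp [codeSign, sign_mul]⟩
  | succ d ih =>
    intro J hJ b q
    obtain ⟨i₀, hi₀, j, hj, τ, q', h0, h⟩ :=
      exists_pivot hs (J := J) (Finset.card_pos.1 (by omega)) b q
    obtain ⟨L, I, hL, hI, hIs, hsign⟩ :=
      ih (J.erase j) (by rw [Finset.card_erase_of_mem hj]; omega) (elim b i₀ j) q'
    refine ⟨(j, τ) :: L, i₀ :: I, by simp [hL], by simp [hI], ?_, fun i hi => ?_⟩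
    · simpa [hi₀] using hIs
    · rw [codeSign, ← hsign i hi, sum_erase_elim hj h0 (h i hi).1]
      exact (h i hi).2

/-- If the functional vanishes on the nonzero vector `b i₀`, then `i₀` can be chosen as the first
pivot. -/
theorem exists_codeSign_cons [DecidableEq κ] {s : Finset ι} (d : ℕ) (J : Finset κ)
    (hJ : J.card = d + 2) (b : ι → κ → ℝ) (q : κ → ℝ) {i₀ : ι} (hi₀ : i₀ ∈ s) {j : κ} (hj : j ∈ J)
    (hij : b i₀ j ≠ 0) (h0 : ∑ k ∈ J, q k * b i₀ k = 0) :
    ∃ (L : List (κ × SignType)) (I : List ι), L.length = d + 2 ∧ I.length = d ∧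
      (∀ i ∈ I, i ∈ s) ∧
      ∀ i ∈ s, SignType.sign (∑ k ∈ J, q k * b i k) = codeSign L (i₀ :: I) b i := by
  obtain ⟨L, I, hL, hI, hIs, hsign⟩ := exists_codeSign ⟨i₀, hi₀⟩ d (J.erase j)
    (by rw [Finset.card_erase_of_mem hj]; omega) (elim b i₀ j) q
  refine ⟨(j, 0) :: L, I, by simp [hL], hI, hIs, fun i hi => ?_⟩
  rw [codeSign, ← hsign i hi, sum_erase_elim hj h0 fun h => absurd h hij]
  split_ifs with h
  · rw [h]; simp
  · rfl

end Codes

/-! ### The sets described by codes -/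

/-- The set of the indices with a positive sign and, if `bit` is set, of the indices with sign zero
up to the first pivot. -/
noncomputable def codeSet {κ : Type*} (n : ℕ) (L : List (κ × SignType)) (bit : Bool) (I : List ℕ)
    (b : ℕ → κ → ℝ) : Finset (Fin n) :=
  {i | codeSign L I b i = 1 ∨ (codeSign L I b i = 0 ∧ bit = true ∧ (i : ℕ) ≤ I.headD 0)}

/-- The vectors `(a_i, 1)`, where the coordinates of the `a_i` are listed in the arrays `R k`. -/
def liftedVec (r : ℕ) (R : ℕ → ℕ → ℝ) (i : ℕ) (k : Fin (r + 1)) : ℝ :=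
  if (k : ℕ) < r then R k i else 1

theorem sum_liftedVec {r n : ℕ} (A : Matrix (Fin r) (Fin n) ℝ) (p : (Fin r → ℝ) × ℝ) (i : Fin n) :
    ∑ k, Fin.snoc (α := fun _ => ℝ) p.1 (-p.2) k * liftedVec r (inputMemory A).real i k =
      lifted A i p := by
  rw [Fin.sum_univ_castSucc]
  simp [liftedVec, inputMemory, lifted, Matrix.mulVec, dotProduct, mul_comm, sub_eq_add_neg]

/-- Every candidate support is described by a code with `r` pivots: the signs are encoded by
`exists_codeSign`, and when some ties belong to the support, the last of them can be taken as the
first pivot and then also tells where the support ends among the ties. -/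
theorem exists_codeSet_eq {r n : ℕ} (hr : 1 ≤ r) (hn : 1 ≤ n) (A : Matrix (Fin r) (Fin n) ℝ)
    {S : Finset (Fin n)} (hS : S ∈ candidateSupports A) :
    ∃ (L : List (Fin (r + 1) × SignType)) (bit : Bool) (I : List ℕ), L.length = r + 1 ∧
      I.length = r ∧ (∀ i ∈ I, i < n) ∧
      codeSet n L bit I (liftedVec r (inputMemory A).real) = S := by
  obtain ⟨p, x, ⟨hx0, hxpos, hxneg, hxtie⟩, rfl⟩ := mem_candidateSupports.1 hS
  obtain ⟨d, rfl⟩ : ∃ d, r = d + 1 := ⟨r - 1, by omega⟩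
  have hcard : (Finset.univ : Finset (Fin (d + 1 + 1))).card = d + 2 := by simp
  have hpos : ∀ i, SignType.sign (lifted A i p) = 1 → x i ≠ 0 := fun i h => by
    rw [sign_eq_one_iff, lifted, sub_pos] at h
    exact (hxpos i h).ne'
  have hneg : ∀ i, SignType.sign (lifted A i p) = -1 → x i = 0 := fun i h => by
    rw [sign_eq_neg_one_iff, lifted, sub_neg] at h
    exact hxneg i h
  have hzero : ∀ i, SignType.sign (lifted A i p) = 0 → A.transpose.mulVec p.1 i = p.2 :=
    fun i h => by rwa [sign_eq_zero_iff, lifted, sub_eq_zero] at h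
  have htri : ∀ σ : SignType, σ = 0 ∨ σ = -1 ∨ σ = 1 := by decide
  by_cases htie : ∃ i, lifted A i p = 0 ∧ x i ≠ 0
  · obtain ⟨i₀, hi₀, hmax⟩ := Finset.exists_max_image
      (Finset.univ.filter fun i => lifted A i p = 0 ∧ x i ≠ 0) id
      (by simpa [Finset.Nonempty] using htie)
    simp only [Finset.mem_filter, Finset.mem_univ, true_and, id] at hi₀ hmax
    obtain ⟨L, I, hL, hI, hIs, hsign⟩ := exists_codeSign_cons (s := Finset.range n) d Finset.univ
      hcard (liftedVec (d + 1) (inputMemory A).real)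
      (Fin.snoc (α := fun _ => ℝ) p.1 (-p.2)) (i₀ := i₀) (by simp) (Finset.mem_univ (Fin.last _))
      (by simp [liftedVec]) (by rw [sum_liftedVec]; exact hi₀.1)
    refine ⟨L, true, i₀ :: I, hL, by simp [hI], by simpa using hIs, ?_⟩
    ext i
    have h := hsign i (by simp)
    rw [sum_liftedVec] at h
    simp only [codeSet, ← h, supp, Finset.mem_filter, Finset.mem_univ, true_and, List.headD_cons,
      Fin.val_fin_le]
    constructor
    · rintro (h1 | ⟨h1, h2⟩)
      · exact hpos i h1
      · rcases h2.lt_or_eq with h2 | rfl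
        · have := hxtie i i₀ h2 (hzero i h1) (hzero i₀ (by simp [hi₀.1]))
          exact ((hx0 i₀).lt_of_ne' hi₀.2 |>.trans_le this).ne'
        · exact hi₀.2
    · intro hx
      rcases htri (SignType.sign (lifted A i p)) with h1 | h1 | h1
      · exact Or.inr ⟨h1, hmax i ⟨sign_eq_zero_iff.1 h1, hx⟩⟩
      · exact absurd (hneg i h1) hx
      · exact Or.inl h1
  · obtain ⟨L, I, hL, hI, hIs, hsign⟩ := exists_codeSign (s := Finset.range n)
      ⟨0, by simp; omega⟩ (d + 1) Finset.univ hcard (liftedVec (d + 1) (inputMemory A).real)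
      (Fin.snoc (α := fun _ => ℝ) p.1 (-p.2))
    refine ⟨L, false, I, hL, hI, by simpa using hIs, ?_⟩
    ext i
    have h := hsign i (by simp)
    rw [sum_liftedVec] at h
    simp only [codeSet, ← h, supp, Finset.mem_filter, Finset.mem_univ, true_and]
    push Not at htie
    constructor
    · rintro (h1 | ⟨-, h2, -⟩)
      · exact hpos i h1
      · simp at h2
    · intro hx
      rcases htri (SignType.sign (lifted A i p)) with h1 | h1 | h1
      · exact absurd (htie i (sign_eq_zero_iff.1 h1)) hx
      · exact absurd (hneg i h1) hx
      · exact Or.inl h1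

theorem ncard_candidateSupports_le {r n : ℕ} (hr : 1 ≤ r) (hn : 1 ≤ n)
    (A : Matrix (Fin r) (Fin n) ℝ) :
    (candidateSupports A).ncard ≤ ((r + 1) * 3) ^ (r + 1) * 2 * n ^ r := by
  have hsub : candidateSupports A ⊆ Set.range
      fun c : (List.Vector (Fin (r + 1) × SignType) (r + 1) × Bool) × List.Vector (Fin n) r =>
        codeSet n c.1.1.1 c.1.2 (c.2.1.map Fin.val) (liftedVec r (inputMemory A).real) := by
    intro S hS
    obtain ⟨L, bit, I, hL, hI, hIn, rfl⟩ := exists_codeSet_eq hr hn A hS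
    lift I to List (Fin n) using hIn
    exact ⟨((⟨L, hL⟩, bit), ⟨I, by simpa using hI⟩), rfl⟩
  refine (Set.ncard_le_ncard hsub (Set.finite_range _)).trans ?_
  rw [← Set.image_univ]
  refine (Set.ncard_image_le Set.finite_univ).trans ?_
  rw [Set.ncard_univ, Nat.card_eq_fintype_card]
  simp only [Fintype.card_prod, card_vector, Fintype.card_fin, Fintype.card_bool]
  exact le_of_eq rfl

/-! ### Frame rules, loop rules and running times of programs -/

/-- The program may assign to the array `nat a`. -/
def Program.WritesNat (a : ℕ) : Program → Prop
  | .skip => False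
  | .setNat b _ _ => a = b
  | .setReal _ _ _ => False
  | .seq P Q => P.WritesNat a ∨ Q.WritesNat a
  | .ifNatLt _ _ P Q => P.WritesNat a ∨ Q.WritesNat a
  | .ifRealLt _ _ P Q => P.WritesNat a ∨ Q.WritesNat a
  | .loop b _ P => a = b ∨ P.WritesNat a
  | .query _ b _ _ => a = b

/-- The program may assign to the array `real a`. -/
def Program.WritesReal (a : ℕ) : Program → Prop
  | .skip => False
  | .setNat _ _ _ => False
  | .setReal b _ _ => a = b
  | .seq P Q => P.WritesReal a ∨ Q.WritesReal a
  | .ifNatLt _ _ P Q => P.WritesReal a ∨ Q.WritesReal a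
  | .ifRealLt _ _ P Q => P.WritesReal a ∨ Q.WritesReal a
  | .loop _ _ P => P.WritesReal a
  | .query _ _ x t => a = x ∨ a = t

theorem Memory.setNat_nat_of_ne (m : Memory) {a b : ℕ} (h : b ≠ a) (i k : ℕ) :
    (m.setNat a i k).nat b = m.nat b := by
  funext j; simp [Memory.setNat, h]

@[simp] theorem Memory.setNat_nat_self (m : Memory) (a i k : ℕ) :
    (m.setNat a i k).nat a i = k := by
  simp [Memory.setNat]

@[simp] theorem Memory.setNat_real (m : Memory) (a i k : ℕ) : (m.setNat a i k).real = m.real := rfl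

theorem loopMemory_induct {a : ℕ} {body : Memory → Memory} {m : Memory} {K : ℕ}
    (Q : ℕ → Memory → Prop) (h0 : Q 0 m)
    (hstep : ∀ k < K, ∀ m', Q k m' → Q (k + 1) (body (m'.setNat a 0 k))) :
    Q K (loopMemory a body m K) := by
  induction K with
  | zero => exact h0
  | succ K ih => exact hstep K K.lt_succ_self _ (ih fun k hk => hstep k (hk.trans K.lt_succ_self))

/-- If the body of a loop preserves `Q` and `R` and round `k₀` turns `Q` into `R`, then the loop
turns `Q` into `R`. -/
theorem loopMemory_reach {a : ℕ} {body : Memory → Memory} {m : Memory} {K k₀ : ℕ} (hk₀ : k₀ < K)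
    (Q R : Memory → Prop) (hQ : ∀ k m', Q m' → Q (body (m'.setNat a 0 k)))
    (hR : ∀ k m', R m' → R (body (m'.setNat a 0 k)))
    (hQR : ∀ m', Q m' → R (body (m'.setNat a 0 k₀))) (h0 : Q m) :
    R (loopMemory a body m K) := by
  have hQ' : ∀ K, Q (loopMemory a body m K) := fun K =>
    loopMemory_induct (fun _ => Q) h0 fun k _ m' => hQ k m'
  induction K with
  | zero => omega
  | succ K ih =>
    rcases (Nat.lt_succ_iff.1 hk₀).lt_or_eq with h | rfl
    · exact hR K _ (ih h)
    · exact hQR _ (hQ' _)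

theorem Program.exec_nat {n : ℕ} (ans : Finset (Fin n) → Option ((Fin n → ℝ) × ℝ)) {a : ℕ}
    (P : Program) (h : ¬P.WritesNat a) (m : Memory) :
    (P.exec ans m).nat a = m.nat a := by
  induction P generalizing m with
  | skip => rfl
  | setNat b i e => exact Memory.setNat_nat_of_ne _ h _ _
  | setReal b i e => rfl
  | seq P Q hP hQ =>
    simp only [WritesNat, not_or] at h
    simp only [exec, hQ h.2, hP h.1]
  | ifNatLt e₁ e₂ P Q hP hQ =>
    simp only [WritesNat, not_or] at h
    simp only [exec]
    split_ifs <;> simp only [hQ h.2, hP h.1]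
  | ifRealLt e₁ e₂ P Q hP hQ =>
    simp only [WritesNat, not_or] at h
    simp only [exec]
    split_ifs <;> simp only [hQ h.2, hP h.1]
  | loop b e P hP =>
    simp only [WritesNat, not_or] at h
    refine loopMemory_induct (fun _ m' => m'.nat a = m.nat a) rfl fun k _ m' hm' => ?_
    rw [hP h.2, Memory.setNat_nat_of_ne _ h.1, hm']
  | query s b x t =>
    simp only [exec]
    cases ans (m.readSet n s) with
    | none => exact Memory.setNat_nat_of_ne _ h _ _
    | some y => exact Memory.setNat_nat_of_ne m h _ _

theorem Program.exec_real {n : ℕ} (ans : Finset (Fin n) → Option ((Fin n → ℝ) × ℝ)) {a : ℕ}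
    (P : Program) (h : ¬P.WritesReal a) (m : Memory) :
    (P.exec ans m).real a = m.real a := by
  induction P generalizing m with
  | skip => rfl
  | setNat b i e => rfl
  | setReal b i e =>
    simp only [WritesReal] at h
    funext j; simp [exec, Memory.setReal, h]
  | seq P Q hP hQ =>
    simp only [WritesReal, not_or] at h
    simp only [exec, hQ h.2, hP h.1]
  | ifNatLt e₁ e₂ P Q hP hQ =>
    simp only [WritesReal, not_or] at h
    simp only [exec]
    split_ifs <;> simp only [hQ h.2, hP h.1]
  | ifRealLt e₁ e₂ P Q hP hQ =>
    simp only [WritesReal, not_or] at h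
    simp only [exec]
    split_ifs <;> simp only [hQ h.2, hP h.1]
  | loop b e P hP =>
    refine loopMemory_induct (fun _ m' => m'.real a = m.real a) rfl fun k _ m' hm' => ?_
    rw [hP h, Memory.setNat_real, hm']
  | query s b x t =>
    simp only [WritesReal, not_or] at h
    simp only [exec]
    cases ans (m.readSet n s) with
    | none => rfl
    | some y =>
      funext j
      simp [Memory.writeAnswer, Memory.setReal, Memory.setVec, Memory.setNat, h.1, h.2]

/-- The running time of the program is bounded independently of the input and the oracle. -/
def Program.ConstTime (P : Program) : Prop :=
  ∃ K, ∀ (n : ℕ) (ans : Finset (Fin n) → Option ((Fin n → ℝ) × ℝ)) (T : ℕ) (m : Memory),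
    P.time ans T m ≤ K

/-- The running time of the program is `O(n ^ d * T)`, where `n` is stored in `nat 0 0` and an
oracle call takes `T ≥ n` steps. -/
def Program.PolyTime (d : ℕ) (P : Program) : Prop :=
  ∃ K, ∀ (n : ℕ) (ans : Finset (Fin n) → Option ((Fin n → ℝ) × ℝ)) (T : ℕ) (m : Memory),
    m.nat 0 0 = n → 1 ≤ n → n ≤ T → P.time ans T m ≤ K * (n ^ d * T)

namespace Program

theorem ConstTime.setNat (a : ℕ) (i e : NatExpr) : ConstTime (.setNat a i e) :=
  ⟨i.cost + e.cost + 1, fun _ _ _ _ => le_rfl⟩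

theorem ConstTime.setReal (a : ℕ) (i : NatExpr) (e : RealExpr) : ConstTime (.setReal a i e) :=
  ⟨i.cost + e.cost + 1, fun _ _ _ _ => le_rfl⟩

theorem ConstTime.ifNatLt {P Q : Program} (hP : P.ConstTime) (hQ : Q.ConstTime) (e₁ e₂ : NatExpr) :
    ConstTime (.ifNatLt e₁ e₂ P Q) := by
  obtain ⟨K, hK⟩ := hP
  obtain ⟨K', hK'⟩ := hQ
  refine ⟨e₁.cost + e₂.cost + 1 + (K + K'), fun n ans T m => ?_⟩
  have h1 := hK n ans T m
  have h2 := hK' n ans T m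
  simp only [time]
  split_ifs <;> omega

theorem ConstTime.ifRealLt {P Q : Program} (hP : P.ConstTime) (hQ : Q.ConstTime)
    (e₁ e₂ : RealExpr) : ConstTime (.ifRealLt e₁ e₂ P Q) := by
  obtain ⟨K, hK⟩ := hP
  obtain ⟨K', hK'⟩ := hQ
  refine ⟨e₁.cost + e₂.cost + 1 + (K + K'), fun n ans T m => ?_⟩
  have h1 := hK n ans T m
  have h2 := hK' n ans T m
  simp only [time]
  split_ifs <;> omega

theorem ConstTime.polyTime {P : Program} (hP : P.ConstTime) (d : ℕ) : P.PolyTime d := by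
  obtain ⟨K, hK⟩ := hP
  refine ⟨K, fun n ans T m _ hn hT => (hK n ans T m).trans ?_⟩
  exact Nat.le_mul_of_pos_right _ (Nat.mul_pos (pow_pos hn d) (hn.trans hT))

theorem PolyTime.skip (d : ℕ) : PolyTime d .skip :=
  ConstTime.polyTime ⟨1, fun _ _ _ _ => le_rfl⟩ d

theorem PolyTime.query (s b x t : ℕ) : PolyTime 0 (.query s b x t) :=
  ⟨1, fun n ans T m _ _ _ => by simp [time]⟩

theorem PolyTime.seq {d : ℕ} {P Q : Program} (hP : P.PolyTime d) (hQ : Q.PolyTime d)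
    (h0 : ¬P.WritesNat 0) : PolyTime d (.seq P Q) := by
  obtain ⟨K, hK⟩ := hP
  obtain ⟨K', hK'⟩ := hQ
  refine ⟨K + K', fun n ans T m hm hn hT => ?_⟩
  rw [add_mul]
  exact add_le_add (hK n ans T m hm hn hT)
    (hK' n ans T _ (by rw [exec_nat ans P h0, hm]) hn hT)

theorem PolyTime.ifNatLt {d : ℕ} {P Q : Program} (hP : P.PolyTime d) (hQ : Q.PolyTime d)
    (e₁ e₂ : NatExpr) : PolyTime d (.ifNatLt e₁ e₂ P Q) := by
  obtain ⟨K, hK⟩ := hP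
  obtain ⟨K', hK'⟩ := hQ
  refine ⟨e₁.cost + e₂.cost + 1 + (K + K'), fun n ans T m hm hn hT => ?_⟩
  have h1 := hK n ans T m hm hn hT
  have h2 := hK' n ans T m hm hn hT
  have h3 : e₁.cost + e₂.cost + 1 ≤ (e₁.cost + e₂.cost + 1) * (n ^ d * T) :=
    Nat.le_mul_of_pos_right _ (Nat.mul_pos (pow_pos hn d) (hn.trans hT))
  simp only [time, add_mul] at h3 ⊢
  split_ifs <;> omega

theorem PolyTime.ifRealLt {d : ℕ} {P Q : Program} (hP : P.PolyTime d) (hQ : Q.PolyTime d)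
    (e₁ e₂ : RealExpr) : PolyTime d (.ifRealLt e₁ e₂ P Q) := by
  obtain ⟨K, hK⟩ := hP
  obtain ⟨K', hK'⟩ := hQ
  refine ⟨e₁.cost + e₂.cost + 1 + (K + K'), fun n ans T m hm hn hT => ?_⟩
  have h1 := hK n ans T m hm hn hT
  have h2 := hK' n ans T m hm hn hT
  have h3 : e₁.cost + e₂.cost + 1 ≤ (e₁.cost + e₂.cost + 1) * (n ^ d * T) :=
    Nat.le_mul_of_pos_right _ (Nat.mul_pos (pow_pos hn d) (hn.trans hT))
  simp only [time, add_mul] at h3 ⊢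
  split_ifs <;> omega

/-- A loop over `0, ..., n - 1` with a body of constant running time takes `O(n)` steps, which are
dominated by the time of one oracle call. -/
theorem ConstTime.loop {P : Program} (hP : P.ConstTime) (a : ℕ) :
    PolyTime 0 (.loop a (.get 0 (.const 0)) P) := by
  obtain ⟨K, hK⟩ := hP
  refine ⟨4 + K, fun n ans T m hm hn hT => ?_⟩
  have hsum := Finset.sum_le_card_nsmul (Finset.range n)
    (fun k => 1 + P.time ans T ((loopMemory a (P.exec ans) m k).setNat a 0 k)) (1 + K)
    fun k _ => Nat.add_le_add_left (hK n ans T _) 1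
  simp only [Finset.card_range, smul_eq_mul] at hsum
  simp only [time, NatExpr.cost, NatExpr.eval, hm]
  have h2 : n * (1 + K) ≤ T * (1 + K) := Nat.mul_le_mul_right _ hT
  have h3 : (4 + K) * (n ^ 0 * T) = 3 * T + T * (1 + K) := by ring
  omega

theorem PolyTime.loop {d : ℕ} {P : Program} (hP : P.PolyTime d) (h0 : ¬P.WritesNat 0) {a : ℕ}
    (ha : a ≠ 0) : PolyTime (d + 1) (.loop a (.get 0 (.const 0)) P) := by
  obtain ⟨K, hK⟩ := hP
  refine ⟨4 + K, fun n ans T m hm hn hT => ?_⟩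
  have hmem : ∀ k, (loopMemory a (P.exec ans) m k).nat 0 = m.nat 0 := fun k =>
    loopMemory_induct (fun _ m' => m'.nat 0 = m.nat 0) rfl fun k _ m' hm' => by
      rw [exec_nat ans P h0, Memory.setNat_nat_of_ne _ ha.symm, hm']
  have hsum := Finset.sum_le_card_nsmul (Finset.range n)
    (fun k => 1 + P.time ans T ((loopMemory a (P.exec ans) m k).setNat a 0 k))
    (1 + K * (n ^ d * T)) fun k _ => Nat.add_le_add_left
      (hK n ans T _ (by rw [Memory.setNat_nat_of_ne _ ha.symm, hmem, hm]) hn hT) 1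
  simp only [Finset.card_range, smul_eq_mul] at hsum
  simp only [time, NatExpr.cost, NatExpr.eval, hm]
  have hpos : 1 ≤ n ^ d * T := Nat.mul_pos (pow_pos hn d) (hn.trans hT)
  have h1 : n * 1 ≤ n * (n ^ d * T) := Nat.mul_le_mul_left n hpos
  have h3 : (4 + K) * (n ^ (d + 1) * T) =
      4 * (n * (n ^ d * T)) + n * (K * (n ^ d * T)) := by ring
  rw [mul_add] at hsum
  omega

end Program

/-! ### Executing a sequence and a nest of loops -/

/-- Run the programs of a list one after the other. -/
def Program.seqList (l : List Program) : Program :=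
  l.foldr .seq .skip

/-- Run `P` for all values in `{0, ..., n - 1} ^ k` of the counters `nat 1 0, ..., nat k 0`. -/
def Program.nest (P : Program) : ℕ → Program
  | 0 => P
  | k + 1 => .loop (k + 1) (.get 0 (.const 0)) (P.nest k)

namespace Program

theorem writesNat_seqList {a : ℕ} {l : List Program} (h : ∀ P ∈ l, ¬P.WritesNat a) :
    ¬(seqList l).WritesNat a := by
  induction l with
  | nil => exact id
  | cons P l ih =>
    simp only [List.forall_mem_cons] at h
    exact not_or.2 ⟨h.1, ih h.2⟩

theorem PolyTime.seqList {d : ℕ} {l : List Program} (h : ∀ P ∈ l, P.PolyTime d)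
    (h0 : ∀ P ∈ l, ¬P.WritesNat 0) : PolyTime d (seqList l) := by
  induction l with
  | nil => exact .skip d
  | cons P l ih =>
    simp only [List.forall_mem_cons] at h h0
    exact .seq h.1 (ih h.2 h0.2) h0.1

theorem exec_seqList_of_invariant {n : ℕ} {ans : Finset (Fin n) → Option ((Fin n → ℝ) × ℝ)}
    {l : List Program} {Q : Memory → Prop} (hQ : ∀ P ∈ l, ∀ m, Q m → Q (P.exec ans m)) {m : Memory}
    (h : Q m) : Q ((seqList l).exec ans m) := by
  induction l generalizing m with
  | nil => exact h
  | cons P l ih =>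
    simp only [List.forall_mem_cons] at hQ
    exact ih hQ.2 (hQ.1 m h)

/-- If all programs of the list preserve `Q` and `R` and one of them turns `Q` into `R`, then the
list turns `Q` into `R`. -/
theorem exec_seqList_of_reach {n : ℕ} {ans : Finset (Fin n) → Option ((Fin n → ℝ) × ℝ)}
    {l : List Program} {Q R : Memory → Prop} (hQ : ∀ P ∈ l, ∀ m, Q m → Q (P.exec ans m))
    (hR : ∀ P ∈ l, ∀ m, R m → R (P.exec ans m)) {P₀ : Program} (hP₀ : P₀ ∈ l)
    (hQR : ∀ m, Q m → R (P₀.exec ans m)) {m : Memory} (h : Q m) : R ((seqList l).exec ans m) := by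
  induction l generalizing m with
  | nil => simp at hP₀
  | cons P l ih =>
    simp only [List.forall_mem_cons] at hQ hR
    rcases List.mem_cons.1 hP₀ with rfl | h'
    · exact exec_seqList_of_invariant hR.2 (hQR m h)
    · exact ih hQ.2 hR.2 h' (hQ.1 m h)

theorem writesNat_nest {P : Program} {a k : ℕ} (hP : ¬P.WritesNat a) (ha : a = 0 ∨ k < a) :
    ¬(P.nest k).WritesNat a := by
  induction k with
  | zero => exact hP
  | succ k ih => exact not_or.2 ⟨by omega, ih (by omega)⟩

theorem PolyTime.nest {P : Program} (hP : P.PolyTime 0) (h0 : ¬P.WritesNat 0) (k : ℕ) :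
    PolyTime k (P.nest k) := by
  induction k with
  | zero => exact hP
  | succ k ih => exact ih.loop (writesNat_nest h0 (Or.inl rfl)) k.succ_ne_zero

theorem exec_nest_of_invariant {n r : ℕ} {ans : Finset (Fin n) → Option ((Fin n → ℝ) × ℝ)}
    {P : Program} {Q : Memory → Prop} (hQP : ∀ m, Q m → Q (P.exec ans m))
    (hQs : ∀ m l v, 1 ≤ l → l ≤ r → Q m → Q (m.setNat l 0 v)) :
    ∀ k ≤ r, ∀ m, Q m → Q ((P.nest k).exec ans m) := by
  intro k
  induction k with
  | zero => exact fun _ => hQP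
  | succ k ih =>
    intro hk m hm
    exact loopMemory_induct (fun _ => Q) hm fun i _ m' hm' =>
      ih (by omega) _ (hQs m' _ i (by omega) hk hm')

/-- If the body of a nest of loops preserves `Q` and `R` and turns `Q` into `R` for the values `I`
of the counters, then the nest turns `Q` into `R`.  The counters from `k + 1` on belong to loops
around the `k` loops considered in the induction, so they have to be fixed already. -/
theorem exec_nest_of_reach {n r : ℕ} {ans : Finset (Fin n) → Option ((Fin n → ℝ) × ℝ)}
    {P : Program} {Q R : Memory → Prop} (hQn : ∀ m, Q m → m.nat 0 0 = n)
    (hQP : ∀ m, Q m → Q (P.exec ans m)) (hRP : ∀ m, R m → R (P.exec ans m))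
    (hQs : ∀ m l v, 1 ≤ l → l ≤ r → Q m → Q (m.setNat l 0 v))
    (hRs : ∀ m l v, 1 ≤ l → l ≤ r → R m → R (m.setNat l 0 v))
    (hPw : ∀ l ≤ r, ¬P.WritesNat l) {I : ℕ → ℕ} (hI : ∀ l, 1 ≤ l → l ≤ r → I l < n)
    (hQR : ∀ m, Q m → (∀ l, 1 ≤ l → l ≤ r → m.nat l 0 = I l) → R (P.exec ans m)) :
    ∀ k ≤ r, ∀ m, Q m → (∀ l, k < l → l ≤ r → m.nat l 0 = I l) → R ((P.nest k).exec ans m) := by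
  intro k
  induction k with
  | zero => exact fun _ => hQR
  | succ k ih =>
    intro hk m hm hmI
    have hset : ∀ (m' : Memory) i, (∀ l, k + 1 < l → l ≤ r → m'.nat l 0 = I l) →
        ∀ l, k + 1 < l → l ≤ r → (m'.setNat (k + 1) 0 i).nat l 0 = I l := by
      intro m' i h l hl hlr
      rw [Memory.setNat_nat_of_ne _ (by omega), h l hl hlr]
    refine loopMemory_reach (k₀ := I (k + 1))
      (by simp only [NatExpr.eval, hQn m hm]; exact hI _ (by omega) hk)
      (fun m' => Q m' ∧ ∀ l, k + 1 < l → l ≤ r → m'.nat l 0 = I l) R ?_ ?_ ?_ ⟨hm, hmI⟩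
    · rintro i m' ⟨hm', hmI'⟩
      refine ⟨exec_nest_of_invariant hQP hQs k (by omega) _ (hQs m' _ i (by omega) hk hm'),
        fun l hl hlr => ?_⟩
      rw [exec_nat ans _ (writesNat_nest (hPw l hlr) (by omega)), hset m' i hmI' l hl hlr]
    · exact fun i m' hm' =>
        exec_nest_of_invariant hRP hRs k (by omega) _ (hRs m' _ i (by omega) hk hm')
    · rintro m' ⟨hm', hmI'⟩
      refine ih (by omega) _ (hQs m' _ _ (by omega) hk hm') fun l hl hlr => ?_
      rcases (show l = k + 1 ∨ k + 1 < l by omega) with rfl | h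
      · simp
      · exact hset m' _ hmI' l h hlr

end Program

/-! ### A program computing the set described by a code -/

section CodeProgram

variable {κ : Type*}

/-- The expressions for the entries after an elimination, where `E e k` is an expression for the
coordinate `k` of the vector whose number is the value of `e`. -/
def elimExpr (E : NatExpr → κ → RealExpr) (e₀ : NatExpr) (j : κ) : NatExpr → κ → RealExpr :=
  fun e k => .sub (E e k) (.mul (.div (E e j) (E e₀ j)) (E e₀ k))

/-- Branch according to the sign `τ * sign x`. -/
def signBranch (τ : SignType) (x : RealExpr) (pos zero neg : Program) : Program :=
  match τ with
  | .zero => zero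
  | .pos => .ifRealLt (.const 0) x pos (.ifRealLt x (.const 0) neg zero)
  | .neg => .ifRealLt (.const 0) x neg (.ifRealLt x (.const 0) pos zero)

/-- Branch according to the sign that a code assigns to the vector whose number is the value of `e`,
where the pivots are the values of expressions. The remainder of the code is tested first, and the
test of its first pair is run if the remainder gives the sign zero. -/
def codeBranch : List (κ × SignType) → List NatExpr → (NatExpr → κ → RealExpr) → NatExpr →
    Program → Program → Program → Program
  | [], _, _, _, _, zero, _ => zero
  | (j, τ) :: _, [], E, e, pos, zero, neg => signBranch τ (E e j) pos zero neg
  | (j, τ) :: L, e₀ :: I, E, e, pos, zero, neg =>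
      codeBranch L I (elimExpr E e₀ j) e pos (signBranch τ (E e j) pos zero neg) neg

theorem exec_signBranch {n : ℕ} (ans : Finset (Fin n) → Option ((Fin n → ℝ) × ℝ)) (τ : SignType)
    (x : RealExpr) (pos zero neg : Program) (m : Memory) :
    (signBranch τ x pos zero neg).exec ans m =
      if τ * SignType.sign (x.eval m) = 1 then pos.exec ans m
      else if τ * SignType.sign (x.eval m) = 0 then zero.exec ans m else neg.exec ans m := by
  have h10 : ¬((0 : SignType) = 1) := by decide
  have h11 : ¬((-1 : SignType) = 1) := by decide
  have h12 : ¬((-1 : SignType) = 0) := by decide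
  have h13 : ¬((1 : SignType) = 0) := by decide
  cases τ
  · simp [signBranch, h10]
  · change (if (((0 : ℕ) : ℝ) < x.eval m) then neg.exec ans m
      else if x.eval m < ((0 : ℕ) : ℝ) then pos.exec ans m else zero.exec ans m) = _
    rw [Nat.cast_zero, show SignType.neg = -1 from rfl]
    rcases lt_trichotomy (x.eval m) 0 with h | h | h
    · simp [h, h.asymm]
    · simp [h, h10]
    · simp [h, h11, h12]
  · change (if (((0 : ℕ) : ℝ) < x.eval m) then pos.exec ans m
      else if x.eval m < ((0 : ℕ) : ℝ) then neg.exec ans m else zero.exec ans m) = _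
    rw [Nat.cast_zero, show SignType.pos = 1 from rfl]
    rcases lt_trichotomy (x.eval m) 0 with h | h | h
    · simp [h, h.asymm, h11, h12]
    · simp [h, h10]
    · simp [h]

theorem exec_codeBranch {n : ℕ} (ans : Finset (Fin n) → Option ((Fin n → ℝ) × ℝ)) (m : Memory)
    (L : List (κ × SignType)) :
    ∀ (I : List NatExpr) (E : NatExpr → κ → RealExpr) (b : ℕ → κ → ℝ),
      (∀ e k, (E e k).eval m = b (e.eval m) k) → ∀ (e : NatExpr) (pos zero neg : Program),
      (codeBranch L I E e pos zero neg).exec ans m =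
        if codeSign L (I.map (NatExpr.eval m)) b (e.eval m) = 1 then pos.exec ans m
        else if codeSign L (I.map (NatExpr.eval m)) b (e.eval m) = 0 then zero.exec ans m
        else neg.exec ans m := by
  have h10 : ¬((0 : SignType) = 1) := by decide
  induction L with
  | nil => intro I E b hE e pos zero neg; simp [codeBranch, codeSign, h10]
  | cons c L ih =>
    obtain ⟨j, τ⟩ := c
    intro I E b hE e pos zero neg
    cases I with
    | nil => simp [codeBranch, codeSign, exec_signBranch, hE]
    | cons e₀ I =>
      have hE' : ∀ e k, (elimExpr E e₀ j e k).eval m = elim b (e₀.eval m) j (e.eval m) k :=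
        fun e k => by simp [elimExpr, elim, RealExpr.eval, hE]
      rw [codeBranch, ih I _ _ hE', exec_signBranch, hE, List.map_cons, codeSign]
      by_cases h : codeSign L (I.map (NatExpr.eval m)) (elim b (e₀.eval m) j) (e.eval m) = 0
      · simp [h, h10]
      · simp [h]

/-- A property of programs that is preserved by branching on real numbers passes from the three
alternatives to the whole branching program. -/
theorem forall_codeBranch {p : Program → Prop} {pos neg : Program} (hpos : p pos) (hneg : p neg)
    (hif : ∀ e₁ e₂ P Q, p P → p Q → p (.ifRealLt e₁ e₂ P Q)) (e : NatExpr)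
    (L : List (κ × SignType)) :
    ∀ (I : List NatExpr) (E : NatExpr → κ → RealExpr) (zero : Program), p zero →
      p (codeBranch L I E e pos zero neg) := by
  have hsign : ∀ τ x zero, p zero → p (signBranch τ x pos zero neg) := by
    intro τ x zero h
    cases τ
    · exact h
    · exact hif _ _ _ _ hneg (hif _ _ _ _ hpos h)
    · exact hif _ _ _ _ hpos (hif _ _ _ _ hneg h)
  induction L with
  | nil => exact fun I E zero h => h
  | cons c L ih =>
    intro I E zero h
    cases I with
    | nil => exact hsign _ _ _ h
    | cons e₀ I => exact ih _ _ _ (hsign _ _ _ h)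

end CodeProgram

/-! ### The enumeration program -/

/-! The natural-number arrays `1, ..., r` hold the pivots, `r + 1` is the counter of inner loops,
`r + 2` holds the indicator of the current set, `r + 3` the answer bit of the oracle, and
`nat (r + 4) 0` tells whether a solution has been found. The real arrays `r + 1` and `r + 2` hold
the answer of the oracle, and `r` and `r + 3` the best solution so far and its value. -/

/-- Write the indicator of the set described by a code with the pivots `nat 1 0, ..., nat r 0`. -/
def buildSet (r : ℕ) (L : List (Fin (r + 1) × SignType)) (bit : Bool) : Program :=
  .loop (r + 1) (.get 0 (.const 0))
    (codeBranch L ((List.range r).map fun l => .get (l + 1) (.const 0))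
      (fun e k => if (k : ℕ) < r then .get k e else .const 1) (.get (r + 1) (.const 0))
      (.setNat (r + 2) (.get (r + 1) (.const 0)) (.const 1))
      (if bit then
        .ifNatLt (.get 1 (.const 0)) (.get (r + 1) (.const 0))
          (.setNat (r + 2) (.get (r + 1) (.const 0)) (.const 0))
          (.setNat (r + 2) (.get (r + 1) (.const 0)) (.const 1))
      else .setNat (r + 2) (.get (r + 1) (.const 0)) (.const 0))
      (.setNat (r + 2) (.get (r + 1) (.const 0)) (.const 0)))

/-- Make the answer of the oracle the best solution so far. -/
def copyAnswer (r : ℕ) : Program :=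
  .seq (.loop (r + 1) (.get 0 (.const 0))
      (.setReal r (.get (r + 1) (.const 0)) (.get (r + 1) (.get (r + 1) (.const 0)))))
    (.seq (.setReal (r + 3) (.const 0) (.get (r + 2) (.const 0)))
      (.setNat (r + 4) (.const 0) (.const 1)))

/-- Call the oracle on the current set and keep the better one of its answer and the best solution
so far. -/
def tryCurrentSet (r : ℕ) : Program :=
  .seq (.query (r + 2) (r + 3) (r + 1) (r + 2))
    (.ifNatLt (.const 0) (.get (r + 3) (.const 0))
      (.ifNatLt (.const 0) (.get (r + 4) (.const 0))
        (.ifRealLt (.get (r + 3) (.const 0)) (.get (r + 2) (.const 0)) (copyAnswer r) .skip)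
        (copyAnswer r))
      .skip)

/-- Try the set described by a code. -/
def tryCode (r : ℕ) (c : List.Vector (Fin (r + 1) × SignType) (r + 1) × Bool) : Program :=
  .seq (buildSet r c.1.1 c.2) (tryCurrentSet r)

/-- Try, for all values of the `r` pivots, the sets described by all codes. -/
noncomputable def enumerateCodes (r : ℕ) : Program :=
  (Program.seqList (Finset.univ.toList.map (tryCode r))).nest r

theorem buildSet_body {r : ℕ} (p : Program → Prop)
    (hset : ∀ e, p (.setNat (r + 2) (.get (r + 1) (.const 0)) e))
    (hif : ∀ e₁ e₂ P Q, p P → p Q → p (.ifRealLt e₁ e₂ P Q))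
    (hif' : ∀ e₁ e₂ P Q, p P → p Q → p (.ifNatLt e₁ e₂ P Q))
    (L : List (Fin (r + 1) × SignType)) (bit : Bool) :
    ∃ P, p P ∧ buildSet r L bit = .loop (r + 1) (.get 0 (.const 0)) P := by
  refine ⟨_, forall_codeBranch (hset _) (hset _) hif _ _ _ _ _ ?_, rfl⟩
  cases bit
  · exact hset _
  · exact hif' _ _ _ _ (hset _) (hset _)

theorem writesNat_buildSet {r a : ℕ} (h1 : a ≠ r + 1) (h2 : a ≠ r + 2)
    (L : List (Fin (r + 1) × SignType)) (bit : Bool) : ¬(buildSet r L bit).WritesNat a := by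
  obtain ⟨P, hP, h⟩ := buildSet_body (fun P => ¬P.WritesNat a) (fun _ => h2)
    (fun _ _ _ _ hP hQ => not_or.2 ⟨hP, hQ⟩) (fun _ _ _ _ hP hQ => not_or.2 ⟨hP, hQ⟩) L bit
  rw [h]
  exact not_or.2 ⟨h1, hP⟩

theorem writesReal_buildSet {r a : ℕ} (L : List (Fin (r + 1) × SignType)) (bit : Bool) :
    ¬(buildSet r L bit).WritesReal a := by
  obtain ⟨P, hP, h⟩ := buildSet_body (fun P => ¬P.WritesReal a) (fun _ => id)
    (fun _ _ _ _ hP hQ => not_or.2 ⟨hP, hQ⟩) (fun _ _ _ _ hP hQ => not_or.2 ⟨hP, hQ⟩) L bit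
  rw [h]
  exact hP

theorem polyTime_buildSet {r : ℕ} (L : List (Fin (r + 1) × SignType)) (bit : Bool) :
    (buildSet r L bit).PolyTime 0 := by
  obtain ⟨P, hP, h⟩ := buildSet_body Program.ConstTime (fun _ => .setNat _ _ _)
    (fun _ _ _ _ hP hQ => hP.ifRealLt hQ _ _) (fun _ _ _ _ hP hQ => hP.ifNatLt hQ _ _) L bit
  rw [h]
  exact hP.loop _

theorem readSet_exec_buildSet {n r : ℕ} (hr : 1 ≤ r)
    (ans : Finset (Fin n) → Option ((Fin n → ℝ) × ℝ))
    (L : List (Fin (r + 1) × SignType)) (bit : Bool) {m : Memory} (hn : m.nat 0 0 = n) :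
    ((buildSet r L bit).exec ans m).readSet n (r + 2) =
      codeSet n L bit ((List.range r).map fun l => m.nat (l + 1) 0) (liftedVec r m.real) := by
  set I := (List.range r).map fun l => m.nat (l + 1) 0 with hI
  set b := liftedVec r m.real with hb
  have hhead : I.headD 0 = m.nat 1 0 := by
    obtain ⟨d, rfl⟩ : ∃ d, r = d + 1 := ⟨r - 1, by omega⟩
    simp [hI, List.range_succ_eq_map]
  suffices H : ∀ i < n, (((buildSet r L bit).exec ans m).nat (r + 2) i ≠ 0 ↔
      (codeSign L I b i = 1 ∨ (codeSign L I b i = 0 ∧ bit = true ∧ i ≤ I.headD 0))) by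
    ext i
    simpa [Memory.readSet, codeSet] using H i i.2
  intro i hi
  refine (loopMemory_induct (K := m.nat 0 0) (fun k m' => m'.real = m.real ∧
    (∀ a ≤ r, m'.nat a = m.nat a) ∧ ∀ i < k, (m'.nat (r + 2) i ≠ 0 ↔
      (codeSign L I b i = 1 ∨ (codeSign L I b i = 0 ∧ bit = true ∧ i ≤ I.headD 0))))
    ⟨rfl, fun _ _ => rfl, by simp⟩ ?_).2.2 i (hn ▸ hi)
  rintro k - m' ⟨hreal, hnat, hdone⟩
  -- one round of the loop writes one entry of the indicator
  have hbody : ∀ v, (m'.setNat (r + 1) 0 k).setNat (r + 2) k v =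
      (Program.setNat (r + 2) (.get (r + 1) (.const 0)) (.const v)).exec ans
        (m'.setNat (r + 1) 0 k) := by
    intro v
    simp [Program.exec, NatExpr.eval]
  have hstep : ∀ v, (v ≠ 0 ↔ (codeSign L I b k = 1 ∨
      (codeSign L I b k = 0 ∧ bit = true ∧ k ≤ I.headD 0))) →
      (fun m' : Memory => m'.real = m.real ∧ (∀ a ≤ r, m'.nat a = m.nat a) ∧
        ∀ i < k + 1, (m'.nat (r + 2) i ≠ 0 ↔ (codeSign L I b i = 1 ∨
          (codeSign L I b i = 0 ∧ bit = true ∧ i ≤ I.headD 0))))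
        ((m'.setNat (r + 1) 0 k).setNat (r + 2) k v) := by
    intro v hv
    refine ⟨hreal, fun a ha => ?_, fun i hi => ?_⟩
    · rw [Memory.setNat_nat_of_ne _ (by omega), Memory.setNat_nat_of_ne _ (by omega), hnat a ha]
    · rcases (Nat.lt_succ_iff.1 hi).lt_or_eq with h | rfl
      · rw [← hdone i h]
        simp [Memory.setNat, h.ne]
      · simpa using hv
  have hE : ∀ (e : NatExpr) (k' : Fin (r + 1)),
      (if (k' : ℕ) < r then RealExpr.get k' e else .const 1).eval (m'.setNat (r + 1) 0 k) =
        b (e.eval (m'.setNat (r + 1) 0 k)) k' := by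
    intro e k'
    rw [hb, liftedVec]
    split_ifs
    · simp [RealExpr.eval, hreal]
    · simp [RealExpr.eval]
  have hmap : ((List.range r).map fun l => NatExpr.get (l + 1) (.const 0)).map
      (NatExpr.eval (m'.setNat (r + 1) 0 k)) = I := by
    rw [List.map_map, hI]
    refine List.map_congr_left fun l hl => ?_
    have hl' := List.mem_range.1 hl
    simp only [Function.comp, NatExpr.eval]
    rw [Memory.setNat_nat_of_ne _ (by omega), hnat _ (by omega)]
  have he : (NatExpr.get (r + 1) (.const 0)).eval (m'.setNat (r + 1) 0 k) = k := by
    simp [NatExpr.eval]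
  have h1 : (NatExpr.get 1 (.const 0)).eval (m'.setNat (r + 1) 0 k) = I.headD 0 := by
    simp only [NatExpr.eval]
    rw [Memory.setNat_nat_of_ne _ (by omega), hnat _ hr, hhead]
  rw [exec_codeBranch ans _ L _ _ b hE, hmap, he]
  split_ifs with c1 c2 c3
  · rw [← hbody]
    exact hstep 1 (by simp [c1])
  · rw [Program.exec, h1, he]
    split_ifs with c4
    · rw [← hbody]
      exact hstep 0 (iff_of_false (by simp) fun h => h.elim c1 fun h => absurd h.2.2 (not_le.2 c4))
    · rw [← hbody]
      exact hstep 1 (iff_of_true one_ne_zero (Or.inr ⟨c2, c3, not_lt.1 c4⟩))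
  · rw [← hbody]
    exact hstep 0 (by simp [c1, c3])
  · rw [← hbody]
    exact hstep 0 (by simp [c1, c2])

theorem exec_copyAnswer {n r : ℕ} (ans : Finset (Fin n) → Option ((Fin n → ℝ) × ℝ)) {m : Memory}
    (hn : m.nat 0 0 = n) :
    ((copyAnswer r).exec ans m).readVec n r = m.readVec n (r + 1) ∧
      ((copyAnswer r).exec ans m).real (r + 3) 0 = m.real (r + 2) 0 ∧
      ((copyAnswer r).exec ans m).nat (r + 4) 0 = 1 := by
  have h := loopMemory_induct (a := r + 1) (K := m.nat 0 0) (m := m) (body := Program.exec ans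
      (.setReal r (.get (r + 1) (.const 0)) (.get (r + 1) (.get (r + 1) (.const 0)))))
    (fun k m' => m'.real (r + 1) = m.real (r + 1) ∧ m'.real (r + 2) = m.real (r + 2) ∧
      ∀ i < k, m'.real r i = m.real (r + 1) i) ⟨rfl, rfl, by simp⟩ (by
    rintro k - m' ⟨h1, h2, h3⟩
    refine ⟨?_, ?_, fun i hi => ?_⟩
    · rw [← h1]; funext j
      simp [Program.exec, Memory.setReal]
    · rw [← h2]; funext j
      simp [Program.exec, Memory.setReal]
    · rcases (Nat.lt_succ_iff.1 hi).lt_or_eq with h | rfl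
      · rw [← h3 i h]
        simp [Program.exec, Memory.setReal, NatExpr.eval, h.ne]
      · rw [← h1]
        simp [Program.exec, Memory.setReal, NatExpr.eval, RealExpr.eval])
  refine ⟨funext fun i => ?_, ?_, ?_⟩
  · rw [Memory.readVec, Memory.readVec, ← h.2.2 i (hn ▸ i.2)]
    simp [copyAnswer, Program.exec, Memory.setReal, NatExpr.eval]
  · rw [← h.2.1]
    simp [copyAnswer, Program.exec, Memory.setReal, NatExpr.eval, RealExpr.eval]
  · simp [copyAnswer, Program.exec, NatExpr.eval]

/-! ### Correctness of the enumeration -/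

/-- If a solution has been found, then it is feasible and its value is stored. -/
def StoresFeasible {r n : ℕ} (A : Matrix (Fin r) (Fin n) ℝ) (f : (Fin r → ℝ) → ℝ)
    (X : Set (Fin n → ℝ)) (m : Memory) : Prop :=
  m.nat (r + 4) 0 ≠ 0 →
    m.readVec n r ∈ X ∧ m.real (r + 3) 0 = objective A f (m.readVec n r)

/-- A solution has been found, and the stored value is at least `v`. -/
def StoresAtLeast (r : ℕ) (v : ℝ) (m : Memory) : Prop :=
  m.nat (r + 4) 0 ≠ 0 ∧ v ≤ m.real (r + 3) 0

theorem exec_tryCurrentSet {n r : ℕ} {A : Matrix (Fin r) (Fin n) ℝ} {f : (Fin r → ℝ) → ℝ}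
    {X : Set (Fin n → ℝ)} {ans : Finset (Fin n) → Option ((Fin n → ℝ) × ℝ)}
    (hans : IsSupportOracle A f X ans) {m : Memory} (hn : m.nat 0 0 = n)
    (hm : StoresFeasible A f X m) :
    StoresFeasible A f X ((tryCurrentSet r).exec ans m) ∧
      (∀ v, StoresAtLeast r v m → StoresAtLeast r v ((tryCurrentSet r).exec ans m)) ∧
      ∀ x t, ans (m.readSet n (r + 2)) = some (x, t) →
        StoresAtLeast r t ((tryCurrentSet r).exec ans m) := by
  set S := m.readSet n (r + 2) with hS
  rcases hy : ans S with _ | ⟨x, t⟩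
  · have hexec : (tryCurrentSet r).exec ans m = m.setNat (r + 3) 0 0 := by
      simp [tryCurrentSet, Program.exec, ← hS, hy, Memory.writeAnswer, NatExpr.eval]
    rw [hexec]
    refine ⟨fun h => ?_, fun v h => ?_, by simp⟩
    · rw [Memory.setNat_nat_of_ne _ (by omega)] at h
      exact hm h
    · rw [StoresAtLeast, Memory.setNat_nat_of_ne _ (by omega)]
      exact h
  · set m₁ := m.writeAnswer (r + 3) (r + 1) (r + 2) (some (x, t)) with hm₁
    have hnat : ∀ a ≠ r + 3, m₁.nat a = m.nat a := fun a ha =>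
      Memory.setNat_nat_of_ne m ha _ _
    have hbit : m₁.nat (r + 3) 0 = 1 := by
      simp [hm₁, Memory.writeAnswer, Memory.setReal, Memory.setVec, Memory.setNat]
    have hval : m₁.real (r + 2) 0 = t := by
      simp [hm₁, Memory.writeAnswer, Memory.setReal]
    have hx : m₁.readVec n (r + 1) = x := by
      funext i
      simp [hm₁, Memory.readVec, Memory.writeAnswer, Memory.setReal, Memory.setVec]
    have hreal : ∀ a, a ≠ r + 1 → a ≠ r + 2 → m₁.real a = m.real a := by
      intro a h1 h2
      funext j
      simp [hm₁, Memory.writeAnswer, Memory.setReal, Memory.setVec, Memory.setNat, h1, h2]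
    have hvec : m₁.readVec n r = m.readVec n r := by
      funext i
      rw [Memory.readVec, hreal r (by omega) (by omega), Memory.readVec]
    have hexec : (tryCurrentSet r).exec ans m =
        if 0 < m.nat (r + 4) 0 then
          if m.real (r + 3) 0 < t then (copyAnswer r).exec ans m₁ else m₁
        else (copyAnswer r).exec ans m₁ := by
      have h4 : m₁.nat (r + 4) 0 = m.nat (r + 4) 0 := by rw [hnat _ (by omega)]
      have h3 : m₁.real (r + 3) 0 = m.real (r + 3) 0 := by rw [hreal _ (by omega) (by omega)]
      simp only [tryCurrentSet, Program.exec, ← hS, hy, ← hm₁, NatExpr.eval, RealExpr.eval, hbit,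
        h4, h3, hval, zero_lt_one, if_true]
    obtain ⟨c1, c2, c3⟩ := exec_copyAnswer (r := r) ans (m := m₁)
      (by rw [hnat _ (by omega), hn])
    rw [hx] at c1
    rw [hval] at c2
    obtain ⟨⟨⟨hxX, -⟩, -⟩, hobj⟩ := (hans S).1 x t hy
    have hcopy : StoresFeasible A f X ((copyAnswer r).exec ans m₁) := fun _ => by
      rw [c1, c2]
      exact ⟨hxX, hobj⟩
    have hcopy' : StoresAtLeast r t ((copyAnswer r).exec ans m₁) := ⟨by simp [c3], c2.ge⟩
    rw [hexec]
    split_ifs with h1 h2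
    · refine ⟨hcopy, fun v hv => ⟨hcopy'.1, hv.2.trans (h2.le.trans hcopy'.2)⟩, ?_⟩
      rintro _ _ ⟨⟩
      exact hcopy'
    · have hkeep : ∀ v, v ≤ m.real (r + 3) 0 → StoresAtLeast r v m₁ := fun v hv => by
        rw [StoresAtLeast, hnat _ (by omega), hreal _ (by omega) (by omega)]
        exact ⟨h1.ne', hv⟩
      refine ⟨fun _ => ?_, fun v hv => hkeep v hv.2, ?_⟩
      · rw [hvec, hreal _ (by omega) (by omega)]
        exact hm h1.ne'
      · rintro _ _ ⟨⟩
        exact hkeep _ (not_lt.1 h2)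
    · refine ⟨hcopy, fun v hv => absurd (Nat.pos_of_ne_zero hv.1) h1, ?_⟩
      rintro _ _ ⟨⟩
      exact hcopy'

theorem writesNat_tryCode {r a : ℕ} (ha : a ≤ r)
    (c : List.Vector (Fin (r + 1) × SignType) (r + 1) × Bool) : ¬(tryCode r c).WritesNat a := by
  refine not_or.2 ⟨writesNat_buildSet (by omega) (by omega) _ _, ?_⟩
  simp only [tryCurrentSet, copyAnswer, Program.WritesNat, or_false, false_or]
  omega

theorem writesReal_tryCode {r a : ℕ} (ha : a < r)
    (c : List.Vector (Fin (r + 1) × SignType) (r + 1) × Bool) : ¬(tryCode r c).WritesReal a := by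
  refine not_or.2 ⟨writesReal_buildSet _ _, ?_⟩
  simp only [tryCurrentSet, copyAnswer, Program.WritesReal, or_false]
  omega

theorem polyTime_tryCode (r : ℕ) (c : List.Vector (Fin (r + 1) × SignType) (r + 1) × Bool) :
    (tryCode r c).PolyTime 0 := by
  have hcopy : (copyAnswer r).PolyTime 0 :=
    .seq ((Program.ConstTime.setReal _ _ _).loop _)
      (.seq ((Program.ConstTime.setReal _ _ _).polyTime 0)
        ((Program.ConstTime.setNat _ _ _).polyTime 0) (by simp [Program.WritesNat]))
      (by simp [Program.WritesNat])
  exact .seq (polyTime_buildSet _ _)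
    (.seq (.query _ _ _ _)
      (.ifNatLt (.ifNatLt (.ifRealLt hcopy (.skip 0) _ _) hcopy _ _) (.skip 0) _ _)
      (by simp [Program.WritesNat]))
    (writesNat_buildSet (by omega) (by omega) _ _)

theorem polyTime_enumerateCodes (r : ℕ) : (enumerateCodes r).PolyTime r := by
  have h0 : ∀ P ∈ Finset.univ.toList.map (tryCode r), ¬P.WritesNat 0 := by
    simp only [List.forall_mem_map]
    exact fun c _ => writesNat_tryCode (Nat.zero_le r) c
  refine .nest (.seqList ?_ h0) (Program.writesNat_seqList h0) r
  simp only [List.forall_mem_map]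
  exact fun c _ => polyTime_tryCode r c

theorem storesFeasible_congr {r n : ℕ} {A : Matrix (Fin r) (Fin n) ℝ} {f : (Fin r → ℝ) → ℝ}
    {X : Set (Fin n → ℝ)} {m m' : Memory} (hnat : m'.nat (r + 4) = m.nat (r + 4))
    (hreal : m'.real = m.real) (h : StoresFeasible A f X m) : StoresFeasible A f X m' := by
  have hvec : m'.readVec n r = m.readVec n r := by
    funext i
    rw [Memory.readVec, hreal, Memory.readVec]
  rwa [StoresFeasible, hnat, hreal, hvec]

theorem storesAtLeast_congr {r : ℕ} {v : ℝ} {m m' : Memory}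
    (hnat : m'.nat (r + 4) = m.nat (r + 4)) (hreal : m'.real = m.real) (h : StoresAtLeast r v m) :
    StoresAtLeast r v m' := by
  simpa only [StoresAtLeast, hnat, hreal] using h

/-- The memory still contains the input, and the stored solution, if any, is feasible. -/
def IsConsistent {r n : ℕ} (A : Matrix (Fin r) (Fin n) ℝ) (f : (Fin r → ℝ) → ℝ)
    (X : Set (Fin n → ℝ)) (m : Memory) : Prop :=
  m.nat 0 0 = n ∧ (∀ a < r, m.real a = (inputMemory A).real a) ∧ StoresFeasible A f X m

theorem exec_tryCode {n r : ℕ} (hr : 1 ≤ r) {A : Matrix (Fin r) (Fin n) ℝ}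
    {f : (Fin r → ℝ) → ℝ} {X : Set (Fin n → ℝ)}
    {ans : Finset (Fin n) → Option ((Fin n → ℝ) × ℝ)} (hans : IsSupportOracle A f X ans)
    (c : List.Vector (Fin (r + 1) × SignType) (r + 1) × Bool) {m : Memory}
    (hm : IsConsistent A f X m) :
    IsConsistent A f X ((tryCode r c).exec ans m) ∧
      (∀ v, StoresAtLeast r v m → StoresAtLeast r v ((tryCode r c).exec ans m)) ∧
      ∀ x t, ans (codeSet n c.1.1 c.2 ((List.range r).map fun l => m.nat (l + 1) 0)
          (liftedVec r (inputMemory A).real)) = some (x, t) →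
        StoresAtLeast r t ((tryCode r c).exec ans m) := by
  obtain ⟨hn, hA, hfeas⟩ := hm
  set m₁ := (buildSet r c.1.1 c.2).exec ans m with hm₁
  have hnat : ∀ a, a ≠ r + 1 → a ≠ r + 2 → m₁.nat a = m.nat a := fun a h1 h2 =>
    Program.exec_nat ans _ (writesNat_buildSet h1 h2 _ _) m
  have hreal : m₁.real = m.real := funext fun a =>
    Program.exec_real ans _ (writesReal_buildSet _ _) m
  have hset : m₁.readSet n (r + 2) = codeSet n c.1.1 c.2
      ((List.range r).map fun l => m.nat (l + 1) 0) (liftedVec r (inputMemory A).real) := by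
    rw [hm₁, readSet_exec_buildSet hr ans _ _ hn]
    congr 1
    funext i k
    simp only [liftedVec]
    split_ifs with h
    · rw [hA k h]
    · rfl
  obtain ⟨h1, h2, h3⟩ := exec_tryCurrentSet hans (m := m₁)
    (by rw [hnat _ (by omega) (by omega), hn])
    (storesFeasible_congr (hnat _ (by omega) (by omega)) hreal hfeas)
  refine ⟨⟨?_, fun a ha => ?_, h1⟩, fun v hv => ?_, fun x t h => ?_⟩
  · rw [Program.exec_nat ans _ (writesNat_tryCode (Nat.zero_le r) c), hn]
  · rw [Program.exec_real ans _ (writesReal_tryCode ha c), hA a ha]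
  · exact h2 v (storesAtLeast_congr (hnat _ (by omega) (by omega)) hreal hv)
  · exact h3 x t (by rw [hset]; exact h)

/-- The output is feasible, and its value is at least the one of the solution that the oracle
returns on the support of an optimal solution, because this support is among the enumerated sets. -/
theorem isOptimalSol_exec_enumerateCodes {n r : ℕ} (hr : 1 ≤ r) (hn : 1 ≤ n)
    {A : Matrix (Fin r) (Fin n) ℝ} {f : (Fin r → ℝ) → ℝ} {X : Set (Fin n → ℝ)}
    {ans : Finset (Fin n) → Option ((Fin n → ℝ) × ℝ)} (hans : IsSupportOracle A f X ans)
    (hopt : ∃ x, IsOptimalSol (objective A f) X x ∧ supp x ∈ candidateSupports A) :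
    IsOptimalSol (objective A f) X
      (((enumerateCodes r).exec ans (inputMemory A)).readVec n r) := by
  obtain ⟨x₀, ⟨hx₀X, hx₀max⟩, hx₀S⟩ := hopt
  obtain ⟨L, bit, I, hL, hI, hIn, hset⟩ := exists_codeSet_eq hr hn A hx₀S
  have hx₀ : IsOptimalSol (objective A f) {x | x ∈ X ∧ supp x = supp x₀} x₀ :=
    ⟨⟨hx₀X, rfl⟩, fun y hy => hx₀max y hy.1⟩
  obtain ⟨⟨x, t⟩, hxt⟩ : ∃ y, ans (supp x₀) = some y := by
    rw [← Option.ne_none_iff_exists']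
    exact fun h => (hans _).2 h ⟨x₀, hx₀⟩
  have ht : objective A f x₀ ≤ t := by
    obtain ⟨h1, h2⟩ := (hans _).1 x t hxt
    rw [h2]
    exact h1.2 x₀ hx₀.1
  set Q := IsConsistent A f X
  set R := fun m => Q m ∧ StoresAtLeast r (objective A f x₀) m
  have hQ : ∀ P ∈ Finset.univ.toList.map (tryCode r), ∀ m, Q m → Q (P.exec ans m) := by
    simp only [List.forall_mem_map]
    exact fun c _ m hm => (exec_tryCode hr hans c hm).1
  have hR : ∀ P ∈ Finset.univ.toList.map (tryCode r), ∀ m, R m → R (P.exec ans m) := by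
    simp only [List.forall_mem_map]
    exact fun c _ m hm =>
      ⟨(exec_tryCode hr hans c hm.1).1, (exec_tryCode hr hans c hm.1).2.1 _ hm.2⟩
  have hQs : ∀ m l v, 1 ≤ l → l ≤ r → Q m → Q (m.setNat l 0 v) := by
    rintro m l v hl hlr ⟨h1, h2, h3⟩
    exact ⟨by rw [Memory.setNat_nat_of_ne _ (by omega), h1], h2,
      storesFeasible_congr (Memory.setNat_nat_of_ne _ (by omega) _ _) rfl h3⟩
  have hRs : ∀ m l v, 1 ≤ l → l ≤ r → R m → R (m.setNat l 0 v) := by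
    rintro m l v hl hlr ⟨h1, h2⟩
    exact ⟨hQs m l v hl hlr h1,
      storesAtLeast_congr (Memory.setNat_nat_of_ne _ (by omega) _ _) rfl h2⟩
  have hw : ∀ l ≤ r, ¬(Program.seqList (Finset.univ.toList.map (tryCode r))).WritesNat l := by
    refine fun l hl => Program.writesNat_seqList ?_
    simp only [List.forall_mem_map]
    exact fun c _ => writesNat_tryCode hl c
  have hinit : Q (inputMemory A) :=
    ⟨by simp [inputMemory], fun _ _ => rfl, fun h => absurd h (by simp [inputMemory])⟩
  obtain ⟨⟨-, -, hfeas⟩, hfound, hval⟩ : R ((enumerateCodes r).exec ans (inputMemory A)) := by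
    -- the counter `l + 1` is the pivot number `l`
    refine Program.exec_nest_of_reach (Q := Q) (I := fun l => I.getD (l - 1) 0) (fun m hm => hm.1)
      (fun m hm => Program.exec_seqList_of_invariant hQ hm)
      (fun m hm => Program.exec_seqList_of_invariant hR hm) hQs hRs hw (fun l hl hlr => ?_)
      (fun m hm hmI => ?_) r le_rfl _ hinit (fun l h1 h2 => absurd h1 (by omega))
    · rw [List.getD_eq_getElem _ _ (by omega)]
      exact hIn _ (List.getElem_mem _)
    · have hmap : ((List.range r).map fun l => m.nat (l + 1) 0) = I := by
        refine List.ext_getElem (by simp [hI]) fun l h1 h2 => ?_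
        rw [List.getElem_map, List.getElem_range, hmI (l + 1) (by omega) (by omega),
          Nat.add_sub_cancel, List.getD_eq_getElem _ _ h2]
      refine Program.exec_seqList_of_reach (Q := fun m' => Q m' ∧ ∀ l ≤ r, m'.nat l = m.nat l)
        ?_ hR (List.mem_map.2 ⟨(⟨L, hL⟩, bit), by simp, rfl⟩) ?_ ⟨hm, fun _ _ => rfl⟩
      · rintro P hP m' ⟨h1, h2⟩
        refine ⟨hQ P hP m' h1, fun l hl => ?_⟩
        obtain ⟨c, -, rfl⟩ := List.mem_map.1 hP
        rw [Program.exec_nat ans _ (writesNat_tryCode hl c), h2 l hl]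
      · rintro m' ⟨h1, h2⟩
        obtain ⟨g1, -, g3⟩ := exec_tryCode hr hans (⟨L, hL⟩, bit) h1
        have hmap' : ((List.range r).map fun l => m'.nat (l + 1) 0) = I := by
          rw [← hmap]
          refine List.map_congr_left fun l hl => ?_
          rw [h2 (l + 1) (List.mem_range.1 hl)]
        obtain ⟨k1, k2⟩ := g3 x t (by rw [hmap']; exact (congrArg ans hset).trans hxt)
        exact ⟨g1, k1, ht.trans k2⟩
  obtain ⟨hX, hobj⟩ := hfeas hfound
  exact ⟨hX, fun y hy => (hx₀max y hy).trans (hobj ▸ hval)⟩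

end FixedRank

theorem mainTheorem6 (r : ℕ) (hr : 1 ≤ r) :
    (∃ C : ℕ, ∀ (n : ℕ) (A : Matrix (Fin r) (Fin n) ℝ), A.rank = r →
      (FixedRank.candidateSupports A).ncard ≤ C * n ^ r ∧
      ∀ (X : Set (Fin n → ℝ)) (f : (Fin r → ℝ) → ℝ),
        (∀ x ∈ X, ∀ i, 0 ≤ x i) → FixedRank.StandardComonotone X →
        ConvexOn ℝ Set.univ f →
        (∃ x, FixedRank.IsOptimalSol (FixedRank.objective A f) X x) →
        ∃ x, FixedRank.IsOptimalSol (FixedRank.objective A f) X x ∧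
          FixedRank.supp x ∈ FixedRank.candidateSupports A) ∧
    (∃ (P : FixedRank.Program) (C : ℕ), ∀ (n : ℕ) (A : Matrix (Fin r) (Fin n) ℝ), A.rank = r →
      ∀ (X : Set (Fin n → ℝ)) (f : (Fin r → ℝ) → ℝ),
        (∀ x ∈ X, ∀ i, 0 ≤ x i) → FixedRank.StandardComonotone X →
        ConvexOn ℝ Set.univ f →
        (∃ x, FixedRank.IsOptimalSol (FixedRank.objective A f) X x) →
        ∀ (ans : Finset (Fin n) → Option ((Fin n → ℝ) × ℝ)) (T₁ : ℕ),
          FixedRank.IsSupportOracle A f X ans → n ≤ T₁ →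
          P.time ans T₁ (FixedRank.inputMemory A) ≤ C * (n ^ r * T₁) ∧
          FixedRank.IsOptimalSol (FixedRank.objective A f) X
            ((P.exec ans (FixedRank.inputMemory A)).readVec n r)) := by
  have hn : ∀ (n : ℕ) (A : Matrix (Fin r) (Fin n) ℝ), A.rank = r → 1 ≤ n := fun n A hA => by
    have := A.rank_le_width
    omega
  obtain ⟨K, hK⟩ := FixedRank.polyTime_enumerateCodes r
  refine ⟨⟨((r + 1) * 3) ^ (r + 1) * 2, fun n A hA => ⟨?_, fun X f hX0 hX hf hopt => ?_⟩⟩,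
    FixedRank.enumerateCodes r, K, fun n A hA X f hX0 hX hf hopt ans T₁ hans hT => ⟨?_, ?_⟩⟩
  · exact FixedRank.ncard_candidateSupports_le hr (hn n A hA) A
  · exact FixedRank.exists_optimal_supp_mem_candidateSupports A hX0 hX hf hopt
  · exact hK n ans T₁ _ (by simp [FixedRank.inputMemory]) (hn n A hA) hT
  · exact FixedRank.isOptimalSol_exec_enumerateCodes hr (hn n A hA) hans
      (FixedRank.exists_optimal_supp_mem_candidateSupports A hX0 hX hf hopt)
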